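/- **Notation.** Let $d$ be a positive integer with $d\equiv 0$ or $3 \pmod 4$. Let $\mathcal Q_d$ be the set of positive definite integral binary quadratic forms $Q=aX^2+bXY+cY^2$ (primitive or not) with $b^2-4ac=-d$, let $\Gamma=\mathrm{SL}_2(\mathbb Z)$ act on it by substitution, and put $\alpha_Q=\frac{-b+i\sqrt d}{2a}$. Let $w_Q=3$ if $Q$ is $\Gamma$-equivalent to a form $m(X^2+XY+Y^2)$, $w_Q=2$ if $Q$ is $\Gamma$-equivalent to a form $m(X^2+Y^2)$, and $w_Q=1$ otherwise. Write $q=e^{2\pi i\tau}$. For $n\ge 1$ let $J_n$ be the $\Gamma$-invariant holomorphic function on the upper half-plane $\mathbb H$ with $J_n=q^{-n}+O(q)$ as $\mathrm{Im}\,\tau\to\infty$, and let $j=J_1+744$. Put $$H(d)=\sum_{Q\in\mathcal Q_d/\Gamma}\frac1{w_Q},\qquad t_n(d)=\sum_{Q\in\mathcal Q_d/\Gamma}\frac{J_n(\alpha_Q)}{w_Q},\qquad \mathcal H_d(X)=\prod_{Q\in\mathcal Q_d/\Gamma}(X-j(\alpha_Q))^{1/w_Q},$$ $$\Lambda_d(\tau)=-\frac1{2\pi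 i}\frac{d}{d\tau}\log\mathcal H_d(j(\tau))=-\frac1{2\pi i}\sum_{Q\in\mathcal Q_d/\Gamma}\frac1{w_Q}\,\frac{j'(\tau)}{j(\tau)-j(\alpha_Q)} .$$ A meromorphic modular form of weight $k$ is a quotient of holomorphic modular forms for $\Gamma$ of weights $k_1,k_2$, the denominator not identically zero, with $k=k_1-k_2$. Let $f=\sum_{n\ge0}c_f(n)q^n$ (for $\mathrm{Im}\,\tau$ large) be a meromorphic modular form of weight $k$ that is regular at the cusp. For $\mathrm{Re}(s)>\max(0,k)$ put $$L_f^*(s)^{\rm reg}=\lim_{\epsilon\to0^+}\ \lim_{\Lambda\to\infty}\ \frac12\sum_{\pm}\int_{\gamma(\Lambda,\pm\epsilon)}\frac{d\tau}{\tau}\Big(\frac{\tau}{i}\Big)^{s}\big(f(\tau)-c_f(0)\big),$$ where $\gamma(\Lambda,\pm\epsilon)$ runs from $i/\Lambda$ to $i\Lambda$ along the imaginary axis, except that it avoids each of the finitely many poles of $f$ on that axis by a semicircle of radius $\epsilon$ about the pole, to the right of the axis for $+\epsilon$ and to the left of it for $-\epsilon$. The regularized L-function $L_f^{\rm reg}(s)$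 is the meromorphic continuation to $s\in\mathbb C$ of $\frac{(2\pi)^s}{\Gamma(s)}L_f^*(s)^{\rm reg}$, and ${\rm reg}\sum_{n\ge1}c_f(n)$ denotes $\lim_{s\to0}L_f^{\rm reg}(s)$. **Theorem.** For every $n\ge1$ the function $J_n$ exists and is unique. The function $\Lambda_d$ is a meromorphic modular form of weight $2$, regular at the cusp, and $$\Lambda_d(\tau)=H(d)+\sum_{n=1}^\infty t_n(d)\,q^n$$ for all $\tau$ with sufficiently large imaginary part. Its regularized L-function $L^{\rm reg}_{\Lambda_d}(s)$ exists (the limits above exist for $\mathrm{Re}(s)>2$ and the result continues meromorphically to $\mathbb C$), and $$\lim_{s\to0}L^{\rm reg}_{\Lambda_d}(s)=-H(d),\qquad\text{i.e.}\qquad {\rm reg}\sum_{n=1}^\infty t_n(d)=-H(d),$$ while $\lim_{s\to1}L^{\rm reg}_{\Lambda_d}(s)$ exists and is finite. -/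

import Mathlib

open Complex Filter Topology UpperHalfPlane MatrixGroups

noncomputable section

namespace SingularModuli

/-! ### Binary quadratic forms and their classes -/

/-- The integral binary quadratic form `a X² + b X Y + c Y²`. -/
structure IntForm where
  a : ℤ
  b : ℤ
  c : ℤ

/-- The value `Q(x, y)`. -/
def IntForm.eval (Q : IntForm) (x y : ℤ) : ℤ := Q.a * x ^ 2 + Q.b * (x * y) + Q.c * y ^ 2

/-- `SL₂(ℤ)`-equivalence: `Q'(x, y) = Q(p x + q y, r x + s y)` for some `[[p, q], [r, s]]`. -/
def IntForm.Equivalent (Q Q' : IntForm) : Prop :=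
  ∃ g : SL(2, ℤ), ∀ x y : ℤ, Q'.eval x y = Q.eval (g 0 0 * x + g 0 1 * y) (g 1 0 * x + g 1 1 * y)

theorem IntForm.Equivalent.refl (Q : IntForm) : Q.Equivalent Q :=
  ⟨1, fun x y => by simp⟩

theorem IntForm.Equivalent.symm {Q Q' : IntForm} (h : Q.Equivalent Q') : Q'.Equivalent Q := by
  obtain ⟨g, hg⟩ := h
  have hdet : g 0 0 * g 1 1 - g 0 1 * g 1 0 = 1 := by
    rw [← Matrix.det_fin_two]
    exact g.det_coe
  refine ⟨g⁻¹, fun x y => ?_⟩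
  rw [hg]
  simp only [Matrix.SpecialLinearGroup.SL2_inv_expl, Matrix.cons_val', Matrix.cons_val_zero,
    Matrix.cons_val_one, Matrix.cons_val_fin_one]
  congr 1
  · linear_combination (-x) * hdet
  · linear_combination (-y) * hdet

theorem IntForm.Equivalent.trans {Q Q' Q'' : IntForm} (h : Q.Equivalent Q')
    (h' : Q'.Equivalent Q'') : Q.Equivalent Q'' := by
  obtain ⟨g, hg⟩ := h
  obtain ⟨g', hg'⟩ := h'
  refine ⟨g * g', fun x y => ?_⟩
  rw [hg', hg]
  simp only [Matrix.SpecialLinearGroup.coe_mul, Matrix.mul_apply, Fin.sum_univ_two]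
  congr 1 <;> ring

/-- The set `𝒬_d` of positive definite integral binary quadratic forms, primitive or not, of
discriminant `b² - 4 a c = -d`. -/
def Forms (d : ℕ) : Type := {Q : IntForm // 0 < Q.a ∧ Q.b ^ 2 - 4 * Q.a * Q.c = -(d : ℤ)}

instance formsSetoid (d : ℕ) : Setoid (Forms d) where
  r Q Q' := Q.1.Equivalent Q'.1
  iseqv := ⟨fun Q => .refl Q.1, fun h => h.symm, fun h h' => h.trans h'⟩

/-- The set of classes `𝒬_d / SL₂(ℤ)`. -/
def FormClass (d : ℕ) : Type := Quotient (formsSetoid d)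

/-- A form in the given class. -/
def FormClass.rep {d : ℕ} (C : FormClass d) : IntForm := (Quotient.out C).1

open Classical in
/-- The weight `w_Q`: `3` for the class of `m (X² + X Y + Y²)`, `2` for the class of
`m (X² + Y²)`, and `1` otherwise. -/
def FormClass.w {d : ℕ} (C : FormClass d) : ℕ :=
  if ∃ m : ℤ, C.rep.Equivalent ⟨m, m, m⟩ then 3
  else if ∃ m : ℤ, C.rep.Equivalent ⟨m, 0, m⟩ then 2
  else 1

/-- The CM point `α_Q = (-b + i √d) / (2 a)` of a form in the class. For `d > 0` this number lies
in the upper half-plane, on which `ofComplex` is the identity. -/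
def FormClass.alpha {d : ℕ} (C : FormClass d) : ℍ :=
  ofComplex ((-(C.rep.b : ℂ) + Complex.I * (Real.sqrt d : ℂ)) / (2 * (C.rep.a : ℂ)))

/-- The Hurwitz class number `H(d) = ∑_Q 1 / w_Q`. -/
def hurwitz (d : ℕ) : ℚ := ∑ᶠ C : FormClass d, 1 / (C.w : ℚ)

/-! ### Modular functions and traces of singular moduli -/

/-- `q^n = exp (2 π i n τ)`. -/
def qPow (n : ℤ) (τ : ℍ) : ℂ := Complex.exp (2 * Real.pi * Complex.I * n * (τ : ℂ))

/-- `f` is an `SL₂(ℤ)`-invariant holomorphic function on `ℍ` with `f = q^{-n} + O(q)` at the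
cusp. -/
def IsModularFunctionJ (n : ℕ) (f : ℍ → ℂ) : Prop :=
  (∀ (γ : SL(2, ℤ)) (τ : ℍ), f (γ • τ) = f τ) ∧
  DifferentiableOn ℂ (f ∘ ofComplex) {z : ℂ | 0 < z.im} ∧
  (fun τ => f τ - qPow (-n) τ) =O[atImInfty] qPow 1

/-- The unique modular function `J_n = q^{-n} + O(q)`. -/
def modJ (n : ℕ) : ℍ → ℂ := Classical.epsilon (IsModularFunctionJ n)

/-- The `j`-invariant, `j = J_1 + 744`. -/
def jInv (τ : ℍ) : ℂ := modJ 1 τ + 744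

/-- The trace of singular moduli `t_n(d) = ∑_Q J_n(α_Q) / w_Q`. -/
def trace (n d : ℕ) : ℂ := ∑ᶠ C : FormClass d, 1 / (C.w : ℂ) * modJ n C.alpha

/-- `Λ_d = -(1 / 2 π i) d/dτ log ℋ_d(j(τ))` with `ℋ_d(X) = ∏_Q (X - j(α_Q))^{1 / w_Q}`. The
logarithmic derivative of this product of fractional powers is, for every choice of branches, the
sum of `1 / w_Q` times the logarithmic derivatives of its factors. -/
def Lam (d : ℕ) (τ : ℍ) : ℂ :=
  -(1 / (2 * Real.pi * Complex.I)) * ∑ᶠ C : FormClass d,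
    1 / (C.w : ℂ) * logDeriv (fun z : ℂ => jInv (ofComplex z) - jInv C.alpha) (τ : ℂ)

/-! ### Meromorphic modular forms -/

/-- `f` is a meromorphic modular form of weight `k` for `SL₂(ℤ)`: a quotient of two holomorphic
modular forms, the second one not identically zero. (A Lean function has some value at its poles
too; this value is irrelevant.) -/
def IsMeromorphicModularForm (k : ℤ) (f : ℍ → ℂ) : Prop :=
  ∃ (k₁ k₂ : ℤ) (f₁ : ModularForm 𝒮ℒ k₁) (f₂ : ModularForm 𝒮ℒ k₂),
    f₂ ≠ 0 ∧ k = k₁ - k₂ ∧ ∀ τ : ℍ, f₂ τ ≠ 0 → f τ = f₁ τ / f₂ τ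

/-- `f = ∑_{n ≥ 0} c(n) q^n` for all `τ` of sufficiently large imaginary part; in particular `f`
is regular at the cusp. -/
def HasQExpansion (f : ℍ → ℂ) (c : ℕ → ℂ) : Prop :=
  ∀ᶠ τ in atImInfty, HasSum (fun n : ℕ => c n * qPow n τ) (f τ)

/-! ### The regularized L-function -/

/-- The set of `y > 0` such that `f` has a pole at `i y`. -/
def axisPoles (f : ℍ → ℂ) : Set ℝ :=
  {y : ℝ | 0 < y ∧ meromorphicOrderAt (f ∘ ofComplex) (Complex.I * (y : ℂ)) < 0}

/-- The integrand `τ⁻¹ (τ / i)^s (f(τ) - c_f(0))`, for `f` regular at the cusp. -/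
def integrand (f : ℍ → ℂ) (s τ : ℂ) : ℂ :=
  τ⁻¹ * (τ / Complex.I) ^ s * (f (ofComplex τ) - valueAtInfty f)

/-- The integral of the integrand over the contour `γ(Λ, ±ε)` from `i / Λ` to `i Λ`, which runs
along the imaginary axis, except that it avoids each pole `i y` on the axis by the semicircle
`τ = i (y - ε e^{σ i θ})`, `0 ≤ θ ≤ π`, of radius `ε` about the pole. The semicircle lies to the
right of the axis for `σ = 1` and to the left of it for `σ = -1`. -/
def contourIntegral (f : ℍ → ℂ) (s : ℂ) (Λ ε σ : ℝ) : ℂ :=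
  (∫ t in {t : ℝ | t ∈ Set.Icc Λ⁻¹ Λ ∧ ∀ y ∈ axisPoles f, ε < |t - y|},
    integrand f s (Complex.I * (t : ℂ)) * Complex.I) +
  ∑ᶠ y ∈ axisPoles f ∩ Set.Ioo Λ⁻¹ Λ, ∫ θ in (0 : ℝ)..Real.pi,
    integrand f s (Complex.I * ((y : ℂ) - (ε : ℂ) * Complex.exp ((σ : ℂ) * Complex.I * (θ : ℂ)))) *
      ((ε : ℂ) * (σ : ℂ) * Complex.exp ((σ : ℂ) * Complex.I * (θ : ℂ)))

/-- The limit, as `Λ → ∞` and then `ε → 0`, of the average of the integrals over `γ(Λ, ε)` and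
`γ(Λ, -ε)` exists and equals `v`. There are only finitely many poles on the axis. -/
def HasRegIntegral (f : ℍ → ℂ) (s v : ℂ) : Prop :=
  (axisPoles f).Finite ∧
  ∃ G : ℝ → ℂ,
    (∀ᶠ ε in 𝓝[>] (0 : ℝ), Tendsto
      (fun Λ : ℝ => (contourIntegral f s Λ ε 1 + contourIntegral f s Λ ε (-1)) / 2)
      atTop (𝓝 (G ε))) ∧
    Tendsto G (𝓝[>] 0) (𝓝 v)

/-- `L` is the regularized L-function of a form `f` of weight `k`: a meromorphic function on `ℂ`
which equals `(2 π)^s / Γ(s)` times the regularized integral in the half-plane `Re s > 0`,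
`Re (s - k) > 0`, where the limits exist. Two such functions agree off a discrete set. -/
def IsRegLFunction (k : ℤ) (f : ℍ → ℂ) (L : ℂ → ℂ) : Prop :=
  Meromorphic L ∧
  ∀ s : ℂ, 0 < s.re → (k : ℝ) < s.re →
    ∃ v : ℂ, HasRegIntegral f s v ∧
      L s = ((2 * Real.pi : ℝ) : ℂ) ^ s / Complex.Gamma s * v

/-- `reg ∑_{n ≥ 1} a(n) = v`: for a meromorphic modular form with coefficients `a(n)`, `n ≥ 1`,
and regular at the cusp, the regularized L-function tends to `v` at `s = 0`. -/
def HasRegSum (a : ℕ → ℂ) (v : ℂ) : Prop :=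
  ∃ (k : ℤ) (f : ℍ → ℂ) (c₀ : ℂ) (L : ℂ → ℂ),
    IsMeromorphicModularForm k f ∧
    HasQExpansion f (fun n => if n = 0 then c₀ else a n) ∧
    IsRegLFunction k f L ∧
    Tendsto L (𝓝[≠] 0) (𝓝 v)

end SingularModuli

end

open MeasureTheory
open scoped ModularForm

noncomputable section

namespace SingularModuli

/-! Since `FormClass d` is finite, Λ_d is a finite combination, with coefficients 1 / w_Q, of the
functions `lamTerm x` = -(1 / 2πi) j' / (j - x) at x = j(α_Q). Everything is proved for such
combinations, with constant term c₀ equal to the sum of the coefficients; for Λ_d this is H(d).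

Coefficients. At the cusp j = u(q) / q with u analytic and u(0) = 1, and `lamTerm x` becomes φ = (u
- q u') / (u - x q). Its n-th Taylor coefficient is a polynomial in x, the n-th Faber polynomial of
u(q) / q. Evaluated at x = j(τ), the same polynomial gives an invariant function q^{-n} + O(q). Such
a function is unique, so the coefficient is J_n (`exists_faber`, `taylorCoeff_eq_modJ`).

Modularity. The derivative of j has weight 2, and multiplication by Δ clears the poles at the cusp
of both j' and j - x. Hence `lamTerm x` is a quotient of forms of weights 14 and 12.

L-function. A logarithmic derivative has at most simple poles. On the imaginary axis, weight 2 gives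
f(i / t) = -t² f(i t). Near each of the finitely many poles p an odd, compactly supported kernel κ(t
- p), asymptotic to 1 / (t - p), is subtracted with the residue as factor. What remains is locally
integrable and unchanged near 0 and ∞, so its Mellin transform is an entire function minus c₀ / s
plus c₀ / (2 - s). The average over the two semicircles is a principal value. As κ is odd, the
principal value of t^{s-1} κ(t - p) is the integral of (t^{s-1} - p^{s-1}) κ(t - p), which is entire
in s (`differentiable_kernelMellin`). Therefore the completed function is A(s) - c₀ / s + c₀ / (2 -
s) with A entire (`IsSimpleAxisForm.exists_completed`).

After division by Γ(s), only the pole at s = 0 contributes there. Since 1 / (s Γ(s)) = 1 / Γ(s + 1)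
tends to 1, the limit is -c₀. At s = 1 every factor is continuous. -/

variable {f : ℍ → ℂ} {c₀ : ℂ}

/-! ### Taylor coefficients at the origin -/

/-- The `n`-th Taylor coefficient at the origin. -/
def taylorCoeff (n : ℕ) (f : ℂ → ℂ) : ℂ := (n.factorial : ℂ)⁻¹ * iteratedDeriv n f 0

theorem taylorCoeff_zero (f : ℂ → ℂ) : taylorCoeff 0 f = f 0 := by simp [taylorCoeff]

theorem taylorCoeff_congr {f g : ℂ → ℂ} (n : ℕ) (h : f =ᶠ[𝓝 0] g) :
    taylorCoeff n f = taylorCoeff n g := by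
  rw [taylorCoeff, taylorCoeff, h.iteratedDeriv_eq]

theorem taylorCoeff_add {f g : ℂ → ℂ} (n : ℕ) (hf : AnalyticAt ℂ f 0) (hg : AnalyticAt ℂ g 0) :
    taylorCoeff n (fun q => f q + g q) = taylorCoeff n f + taylorCoeff n g := by
  rw [taylorCoeff, iteratedDeriv_fun_add hf.contDiffAt hg.contDiffAt, mul_add]
  rfl

theorem taylorCoeff_sub {f g : ℂ → ℂ} (n : ℕ) (hf : AnalyticAt ℂ f 0) (hg : AnalyticAt ℂ g 0) :
    taylorCoeff n (fun q => f q - g q) = taylorCoeff n f - taylorCoeff n g := by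
  rw [taylorCoeff, iteratedDeriv_fun_sub hf.contDiffAt hg.contDiffAt, mul_sub]
  rfl

theorem taylorCoeff_const_mul {f : ℂ → ℂ} (n : ℕ) (c : ℂ) :
    taylorCoeff n (fun q => c * f q) = c * taylorCoeff n f := by
  rw [taylorCoeff, iteratedDeriv_const_mul_field, taylorCoeff]
  ring

theorem taylorCoeff_id_mul {f : ℂ → ℂ} (n : ℕ) (hf : AnalyticAt ℂ f 0) :
    taylorCoeff (n + 1) (fun q => q * f q) = taylorCoeff n f := by
  have h := iteratedDeriv_mul (n := n + 1) (f := fun q : ℂ => q) (g := f) (x := 0)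
    contDiffAt_id hf.contDiffAt
  have h1 : iteratedDeriv (n + 1) (fun q => q * f q) 0 = (n + 1) * iteratedDeriv n f 0 := by
    refine h.trans ?_
    rw [Finset.sum_eq_single 1]
    · simp
    · intro i _ hi
      rcases i with _ | _ | i
      · simp
      · simp at hi
      · simp [iteratedDeriv_fun_id]
    · simp
  rw [taylorCoeff, h1, taylorCoeff, Nat.factorial_succ]
  push_cast
  have : (n : ℂ) + 1 ≠ 0 := by exact_mod_cast n.succ_ne_zero
  field_simp

theorem taylorCoeff_id_mul_deriv {f : ℂ → ℂ} (n : ℕ) (hf : AnalyticAt ℂ f 0) :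
    taylorCoeff n (fun q => q * deriv f q) = n * taylorCoeff n f := by
  rcases n with _ | n
  · simp [taylorCoeff_zero]
  · rw [taylorCoeff_id_mul n hf.deriv, taylorCoeff, taylorCoeff, iteratedDeriv_succ',
      Nat.factorial_succ]
    push_cast
    have : (n : ℂ) + 1 ≠ 0 := by exact_mod_cast n.succ_ne_zero
    field_simp

theorem hasSum_taylorCoeff {f : ℂ → ℂ} (hf : AnalyticAt ℂ f 0) :
    ∀ᶠ q in 𝓝 (0 : ℂ), HasSum (fun n : ℕ => taylorCoeff n f * q ^ n) (f q) := by
  obtain ⟨r, hr, hf'⟩ := Metric.eventually_nhds_iff_ball.1 hf.eventually_analyticAt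
  refine Metric.eventually_nhds_iff_ball.2 ⟨r, hr, fun q hq => ?_⟩
  have := hasSum_taylorSeries_on_ball
    (fun z hz => (hf' z hz).differentiableAt.differentiableWithinAt) hq
  have h2 : (fun n : ℕ => taylorCoeff n f * q ^ n) =
      fun n : ℕ => (n.factorial : ℂ)⁻¹ • (q - 0) ^ n • iteratedDeriv n f 0 := by
    ext n
    simp only [taylorCoeff, sub_zero, smul_eq_mul]
    ring
  rwa [h2]

theorem exists_eq_add_id_mul {f : ℂ → ℂ} (hf : AnalyticAt ℂ f 0) :
    ∃ g : ℂ → ℂ, AnalyticAt ℂ g 0 ∧ ∀ q, f q = f 0 + q * g q := by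
  refine ⟨dslope f 0, ?_, fun q => ?_⟩
  · obtain ⟨p, hp⟩ := hf
    exact ⟨_, hp.has_fpower_series_dslope_fslope⟩
  · have := sub_smul_dslope f 0 q
    simp at this
    rw [this]; ring

/-! ### Faber polynomials of a function with a simple pole -/

/-- If `u` is analytic at `0` and `u(0) = 1`, the principal part of `v(q) / q ^ n` is that of a
polynomial in `u(q) / q`, up to a function vanishing at the origin. The value of the polynomial at
`x` is a Taylor coefficient of `v φ` with `φ = (u - q u') / (u - x q)`. -/
theorem exists_faber {u : ℂ → ℂ} (hu : AnalyticAt ℂ u 0) (hu0 : u 0 = 1) (n : ℕ) :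
    ∀ v : ℂ → ℂ, AnalyticAt ℂ v 0 → ∃ (p : Polynomial ℂ) (R : ℂ → ℂ),
      AnalyticAt ℂ R 0 ∧ R 0 = 0 ∧
      (∀ᶠ q in 𝓝[≠] (0 : ℂ), v q / q ^ n - p.eval (u q / q) = R q) ∧
      ∀ x : ℂ, taylorCoeff n
        (fun q => v q * ((u q - q * deriv u q) / (u q - x * q))) = p.eval x := by
  have hφ (x : ℂ) : AnalyticAt ℂ (fun q => (u q - q * deriv u q) / (u q - x * q)) 0 := by
    refine (hu.sub (analyticAt_id.mul hu.deriv)).div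
      (hu.sub (analyticAt_const.mul analyticAt_id)) (by simp [hu0])
  have hden (x : ℂ) : ∀ᶠ q in 𝓝 (0 : ℂ), u q - x * q ≠ 0 := by
    refine ContinuousAt.eventually_ne ?_ (by simp [hu0])
    exact (hu.sub (analyticAt_const.mul analyticAt_id)).continuousAt
  -- Write φ for the quotient. From (u - x q) φ = u - q u' one gets u^{m+1} φ = (u^{m+1} - q
  -- (u^{m+1})' / (m + 1)) + x q u^m φ. The operator q d/dq multiplies the coefficient of q^{m+1} by
  -- m + 1, so the bracket contributes nothing to it, and the coefficient is x times the previous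
  -- one.
  have hpow (x : ℂ) (m : ℕ) : taylorCoeff m
      (fun q => u q ^ m * ((u q - q * deriv u q) / (u q - x * q))) = x ^ m := by
    induction m with
    | zero => simp [taylorCoeff_zero, hu0]
    | succ m ih =>
      have hder : ∀ᶠ q in 𝓝 (0 : ℂ), deriv (fun q => u q ^ (m + 1)) q
          = (m + 1) * u q ^ m * deriv u q := by
        filter_upwards [hu.eventually_analyticAt] with q hq
        rw [deriv_fun_pow hq.differentiableAt]
        simp
      have h1 : (fun q => u q ^ (m + 1) * ((u q - q * deriv u q) / (u q - x * q))) =ᶠ[𝓝 0]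
          fun q => (u q ^ (m + 1) - (m + 1 : ℂ)⁻¹ * (q * deriv (fun q => u q ^ (m + 1)) q)) +
            q * (x * (u q ^ m * ((u q - q * deriv u q) / (u q - x * q)))) := by
        filter_upwards [hder, hden x] with q hq hq'
        rw [hq]
        have hm : ((m : ℂ) + 1)⁻¹ * (m + 1) = 1 :=
          inv_mul_cancel₀ (by exact_mod_cast m.succ_ne_zero)
        have hD := div_mul_cancel₀ (u q - q * deriv u q) hq'
        linear_combination u q ^ m * hD + u q ^ m * q * deriv u q * hm
      have hum : AnalyticAt ℂ (fun q => u q ^ (m + 1)) 0 := hu.pow _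
      have hqd : AnalyticAt ℂ (fun q => q * deriv (fun q => u q ^ (m + 1)) q) 0 :=
        analyticAt_id.mul hum.deriv
      have hcq : AnalyticAt ℂ
          (fun q => (m + 1 : ℂ)⁻¹ * (q * deriv (fun q => u q ^ (m + 1)) q)) 0 :=
        analyticAt_const.mul hqd
      have hs : AnalyticAt ℂ
          (fun q => u q ^ (m + 1) - (m + 1 : ℂ)⁻¹ * (q * deriv (fun q => u q ^ (m + 1)) q)) 0 :=
        hum.sub hcq
      have hr : AnalyticAt ℂ
          (fun q => x * (u q ^ m * ((u q - q * deriv u q) / (u q - x * q)))) 0 :=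
        analyticAt_const.mul ((hu.pow _).mul (hφ x))
      have hqr : AnalyticAt ℂ
          (fun q => q * (x * (u q ^ m * ((u q - q * deriv u q) / (u q - x * q))))) 0 :=
        analyticAt_id.mul hr
      rw [taylorCoeff_congr _ h1, taylorCoeff_add _ hs hqr, taylorCoeff_sub _ hum hcq,
        taylorCoeff_const_mul, taylorCoeff_id_mul_deriv _ hum, taylorCoeff_id_mul _ hr,
        taylorCoeff_const_mul, ih]
      have : (m : ℂ) + 1 ≠ 0 := by exact_mod_cast m.succ_ne_zero
      push_cast
      field_simp
      ring
  induction n with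
  | zero =>
    intro v hv
    refine ⟨.C (v 0), fun q => v q - v 0, hv.sub analyticAt_const, by simp, by simp, fun x => ?_⟩
    simp [taylorCoeff_zero, hu0]
  | succ n ih =>
    intro v hv
    -- The leading polar term is removed by v = v(0) u^{n+1} + q w, which leaves w / q^n for the
    -- induction hypothesis. This is why the induction runs over all v, although only v = 1 is
    -- needed later.
    obtain ⟨w, hw, hvw⟩ := exists_eq_add_id_mul
      (hv.sub (analyticAt_const (v := v 0) |>.mul (hu.pow (n + 1))))
    simp only [Pi.sub_apply, Pi.mul_apply, Pi.pow_apply, hu0, one_pow, mul_one, sub_self,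
      zero_add] at hvw
    obtain ⟨p, R, hR, hR0, hpR, hp⟩ := ih w hw
    refine ⟨p + .C (v 0) * .X ^ (n + 1), R, hR, hR0, ?_, fun x => ?_⟩
    · filter_upwards [hpR, self_mem_nhdsWithin] with q hq hq0
      have hq0 : q ≠ 0 := hq0
      have h2 : v q = v 0 * u q ^ (n + 1) + q * w q := by rw [← hvw]; ring
      rw [← hq, h2]
      simp only [Polynomial.eval_add, Polynomial.eval_mul, Polynomial.eval_C,
        Polynomial.eval_pow, Polynomial.eval_X, div_pow, add_div, mul_div_assoc, pow_succ]
      field_simp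
      ring
    · have h1 : (fun q => v q * ((u q - q * deriv u q) / (u q - x * q))) = fun q =>
          q * (w q * ((u q - q * deriv u q) / (u q - x * q))) +
          v 0 * (u q ^ (n + 1) * ((u q - q * deriv u q) / (u q - x * q))) := by
        ext q
        have h2 : v q = v 0 * u q ^ (n + 1) + q * w q := by rw [← hvw]; ring
        rw [h2]; ring
      have ha : AnalyticAt ℂ
          (fun q => w q * ((u q - q * deriv u q) / (u q - x * q))) 0 := hw.mul (hφ x)
      have hqa : AnalyticAt ℂ
          (fun q => q * (w q * ((u q - q * deriv u q) / (u q - x * q)))) 0 :=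
        analyticAt_id.mul ha
      have hb : AnalyticAt ℂ
          (fun q => v 0 * (u q ^ (n + 1) * ((u q - q * deriv u q) / (u q - x * q)))) 0 :=
        analyticAt_const.mul ((hu.pow _).mul (hφ x))
      rw [h1, taylorCoeff_add _ hqa hb, taylorCoeff_const_mul, taylorCoeff_id_mul _ ha,
        hp x, hpow x (n + 1)]
      simp

/-! ### The functions `J_n` -/

theorem qPow_eq_zpow (n : ℤ) (τ : ℍ) : qPow n τ = Function.Periodic.qParam 1 τ ^ n := by
  rw [qPow, Function.Periodic.qParam, ← Complex.exp_int_mul]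
  congr 1
  push_cast
  ring

/-- `f` has the expansion `u(q) / q` at the cusp, with `u` analytic at `0` and `u(0) = 1`. -/
def HasCuspForm (f : ℍ → ℂ) (u : ℂ → ℂ) : Prop :=
  AnalyticAt ℂ u 0 ∧ u 0 = 1 ∧
    ∀ᶠ τ : ℍ in atImInfty, f τ = u (Function.Periodic.qParam 1 τ) / Function.Periodic.qParam 1 τ

/-- `f` is holomorphic on `ℍ` and `SL₂(ℤ)`-invariant. -/
def IsInvariantHolomorphic (f : ℍ → ℂ) : Prop :=
  (∀ (γ : SL(2, ℤ)) (τ : ℍ), f (γ • τ) = f τ) ∧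
    DifferentiableOn ℂ (f ∘ ofComplex) {z : ℂ | 0 < z.im}

open EisensteinSeries ModularForm CongruenceSubgroup in
-- The function is E₄³ / Δ: Δ has no zero on ℍ and its product expansion is q times a function equal
-- to 1 at q = 0.
theorem exists_invariantHolomorphic_hasCuspForm :
    ∃ f u, IsInvariantHolomorphic f ∧ HasCuspForm f u := by
  set D : ℂ → ℂ := fun q => ∏' i : ℕ, (1 - q ^ (i + 1)) ^ 24 with hD
  have hDa : AnalyticAt ℂ D 0 :=
    (differentiableOn_tprod_one_sub_pow_pow 24).analyticAt (Metric.ball_mem_nhds _ one_pos)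
  have hD0 : D 0 = 1 := by simp [hD]
  have hE0 : cuspFunction 1 E₄ 0 = 1 := by
    have := E_qExpansion_coeff_zero (k := 4) (by norm_num) ⟨2, rfl⟩
    rwa [qExpansion_coeff, Nat.factorial_zero, iteratedDeriv_zero, Nat.cast_one, inv_one,
      one_mul] at this
  have hEa : AnalyticAt ℂ (cuspFunction 1 E₄) 0 :=
    ModularFormClass.analyticAt_cuspFunction_zero _ one_pos one_mem_strictPeriods_SL
  refine ⟨fun τ => E₄ τ ^ 3 / discriminant τ, fun q => cuspFunction 1 E₄ q ^ 3 / D q,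
    ⟨fun γ τ => ?_, ?_⟩, (hEa.pow 3).div hDa (by simp [hD0]), by simp [hE0, hD0],
    .of_forall fun τ => ?_⟩
  · have : SlashInvariantFormClass (ModularForm 𝒮ℒ 4) Γ(1) 4 := Gamma_one_coe_eq_SL ▸ inferInstance
    have : SlashInvariantFormClass (CuspForm 𝒮ℒ 12) Γ(1) 12 := Gamma_one_coe_eq_SL ▸ inferInstance
    have h1 := SlashInvariantForm.slash_action_eqn_SL'' E₄ (CongruenceSubgroup.mem_Gamma_one γ) τ
    have h2 := SlashInvariantForm.slash_action_eqn_SL'' CuspForm.discriminant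
      (CongruenceSubgroup.mem_Gamma_one γ) τ
    have h3 : denom γ τ ≠ 0 := denom_ne_zero _ _
    simp only [CuspForm.coe_discriminant] at h2
    simp only [h1, h2, ← zpow_natCast]
    have : discriminant τ ≠ 0 := discriminant_ne_zero τ
    norm_num
    field_simp
  · have h1 := UpperHalfPlane.mdifferentiable_iff.1 E₄.holo'
    have h2 := UpperHalfPlane.mdifferentiable_iff.1 CuspForm.discriminant.holo'
    exact (h1.pow 3).div h2 fun z _ => discriminant_ne_zero _
  · have h1 := SlashInvariantFormClass.eq_cuspFunction E₄ τ one_mem_strictPeriods_SL one_ne_zero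
    have hq : Function.Periodic.qParam 1 (τ : ℂ) ∈ Metric.ball (0 : ℂ) 1 := by
      simpa using Function.Periodic.norm_qParam_lt_one one_pos τ.im_pos
    have h2 := SlashInvariantFormClass.eq_cuspFunction CuspForm.discriminant τ
      one_mem_strictPeriods_SL one_ne_zero
    simp only [CuspForm.coe_discriminant] at h2
    rw [discriminant_cuspFunction_eqOn hq] at h2
    simp only [h1, ← h2, hD]
    rw [div_div, mul_comm]

theorem isModularFunctionJ_eval {f : ℍ → ℂ} (hf : IsInvariantHolomorphic f) {u : ℂ → ℂ}
    (hu : HasCuspForm f u) {n : ℕ} {p : Polynomial ℂ} {R : ℂ → ℂ} (hR : AnalyticAt ℂ R 0)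
    (hR0 : R 0 = 0) (hp : ∀ᶠ q in 𝓝[≠] (0 : ℂ), 1 / q ^ n - p.eval (u q / q) = R q) :
    IsModularFunctionJ n fun τ => p.eval (f τ) := by
  refine ⟨fun γ τ => by simp only [hf.1], p.differentiable.comp_differentiableOn hf.2, ?_⟩
  have hq : Tendsto (fun τ : ℍ => Function.Periodic.qParam 1 (τ : ℂ)) atImInfty (𝓝[≠] 0) :=
    (Function.Periodic.qParam_tendsto one_pos).comp tendsto_coe_atImInfty
  have h1 : R =O[𝓝 0] fun q => q := by
    simpa [hR0] using hR.differentiableAt.isBigO_sub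
  have h2 := (h1.comp_tendsto (hq.mono_right nhdsWithin_le_nhds)).neg_left
  refine h2.congr' ?_ ?_
  · filter_upwards [hu.2.2, hq.eventually hp] with τ h3 h4
    rw [h3, qPow_eq_zpow]
    simp only [Function.comp, ← h4, zpow_neg, zpow_natCast]
    ring
  · exact .of_forall fun τ => by simp [qPow_eq_zpow]

/-- The difference is a level one form of weight 0, hence constant, and it vanishes at the cusp. -/
theorem IsModularFunctionJ.unique {n : ℕ} {f g : ℍ → ℂ} (hf : IsModularFunctionJ n f)
    (hg : IsModularFunctionJ n g) : f = g := by
  have hO : (fun τ => f τ - g τ) =O[atImInfty] qPow 1 := by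
    refine (hf.2.2.sub hg.2.2).congr_left fun τ => by ring
  have hz : IsZeroAtImInfty fun τ => f τ - g τ := by
    refine hO.trans_tendsto ?_
    refine (qParam_tendsto_atImInfty one_pos).congr fun τ => by simp [qPow_eq_zpow]
  have hinv (γ : SL(2, ℤ)) : (fun τ => f τ - g τ) ∣[(0 : ℤ)] γ = fun τ => f τ - g τ := by
    ext τ
    simp only [ModularForm.SL_slash_apply, hf.1, hg.1, neg_zero, zpow_zero, mul_one]
  let F : ModularForm 𝒮ℒ 0 :=
    { toFun := fun τ => f τ - g τ
      slash_action_eq' := by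
        rintro _ ⟨γ, rfl⟩
        exact hinv γ
      holo' := UpperHalfPlane.mdifferentiable_iff.2 (hf.2.1.sub hg.2.1)
      bdd_at_cusps' := by
        intro c hc
        rw [Subgroup.IsArithmetic.isCusp_iff_isCusp_SL2Z] at hc
        rw [OnePoint.isBoundedAt_iff_forall_SL2Z hc]
        intro γ _
        rw [hinv]
        exact hz.isBoundedAtImInfty }
  obtain ⟨c, hc⟩ := ModularFormClass.levelOne_weight_zero_const F
  have hc' (τ : ℍ) : f τ - g τ = c := congrFun hc τ
  have : c = 0 := by
    refine tendsto_nhds_unique (f := fun τ : ℍ => f τ - g τ) (l := atImInfty) ?_ hz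
    simp [hc']
  ext τ
  exact sub_eq_zero.1 ((hc' τ).trans this)

theorem exists_isModularFunctionJ (n : ℕ) : ∃ f, IsModularFunctionJ n f := by
  obtain ⟨f, u, hf, hu⟩ := exists_invariantHolomorphic_hasCuspForm
  obtain ⟨p, R, hR, hR0, hp, -⟩ := exists_faber hu.1 hu.2.1 n (fun _ => 1) analyticAt_const
  exact ⟨_, isModularFunctionJ_eval hf hu hR hR0 hp⟩

theorem modJ_spec (n : ℕ) : IsModularFunctionJ n (modJ n) :=
  Classical.epsilon_spec (exists_isModularFunctionJ n)

theorem isInvariantHolomorphic_jInv : IsInvariantHolomorphic jInv :=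
  ⟨fun γ τ => by rw [jInv, (modJ_spec 1).1, jInv], (modJ_spec 1).2.1.add_const _⟩

/-- The asymptotic condition defining J_1 does not by itself say that the expansion is analytic in
q. Uniqueness identifies J_1 with a Faber polynomial in E₄³ / Δ, and this supplies the analyticity.
-/
theorem exists_hasCuspForm_jInv : ∃ u, HasCuspForm jInv u := by
  obtain ⟨f, u, hf, hu⟩ := exists_invariantHolomorphic_hasCuspForm
  obtain ⟨p, R, hR, hR0, hp, -⟩ := exists_faber hu.1 hu.2.1 1 (fun _ => 1) analyticAt_const
  have hJ := (isModularFunctionJ_eval hf hu hR hR0 hp).unique (modJ_spec 1)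
  have hq : Tendsto (fun τ : ℍ => Function.Periodic.qParam 1 (τ : ℂ)) atImInfty (𝓝[≠] 0) :=
    (Function.Periodic.qParam_tendsto one_pos).comp tendsto_coe_atImInfty
  refine ⟨fun q => 1 + q * (744 - R q), ?_, by simp, ?_⟩
  · exact analyticAt_const.add (analyticAt_id.mul (analyticAt_const.sub hR))
  · filter_upwards [hu.2.2, hq.eventually hp] with τ h3 h4
    have h0 : Function.Periodic.qParam 1 (τ : ℂ) ≠ 0 := Function.Periodic.qParam_ne_zero _
    rw [jInv, ← hJ, ← h4]
    simp only [h3]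
    field_simp
    ring

/-- The values of `J_n` are Taylor coefficients of `(u - q u') / (u - x q)`, where
`j = u(q) / q` at the cusp. -/
theorem taylorCoeff_eq_modJ {u : ℂ → ℂ} (hu : HasCuspForm jInv u) (n : ℕ) (τ : ℍ) :
    taylorCoeff n (fun q => (u q - q * deriv u q) / (u q - jInv τ * q)) = modJ n τ := by
  obtain ⟨p, R, hR, hR0, hp, hx⟩ := exists_faber hu.1 hu.2.1 n (fun _ => 1) analyticAt_const
  have hJ := (isModularFunctionJ_eval isInvariantHolomorphic_jInv hu hR hR0 hp).unique
    (modJ_spec n)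
  rw [← hJ]
  simpa using hx (jInv τ)

/-! ### Logarithmic derivatives of `j - x` -/

/-- The normalised logarithmic derivative of `j - x`. -/
def lamTerm (x : ℂ) (τ : ℍ) : ℂ :=
  -(1 / (2 * Real.pi * Complex.I)) * logDeriv (fun z : ℂ => jInv (ofComplex z) - x) (τ : ℂ)

theorem analyticAt_jInv {z : ℂ} (hz : 0 < z.im) :
    AnalyticAt ℂ (fun z : ℂ => jInv (ofComplex z)) z :=
  isInvariantHolomorphic_jInv.2.analyticAt (isOpen_upperHalfPlaneSet.mem_nhds hz)

open Derivative in
theorem lamTerm_eq (x : ℂ) (τ : ℍ) :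
    lamTerm x τ = -normalizedDerivOfComplex jInv τ / (jInv τ - x) := by
  rw [lamTerm, logDeriv_apply, normalizedDerivOfComplex, deriv_sub_const, ofComplex_apply]
  simp only [Function.comp_def]
  ring

open Derivative in
-- In weight 0 the Serre derivative has no E₂ term, so its covariance is that of the plain
-- derivative.
theorem normalizedDeriv_jInv_slash (γ : SL(2, ℤ)) :
    normalizedDerivOfComplex jInv ∣[(2 : ℤ)] γ = normalizedDerivOfComplex jInv := by
  have h0 : jInv ∣[(0 : ℤ)] γ = jInv := by
    ext τ
    simp only [ModularForm.SL_slash_apply, isInvariantHolomorphic_jInv.1, neg_zero, zpow_zero,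
      mul_one]
  have := serreDerivative_slash_invariant (k := 0)
    (UpperHalfPlane.mdifferentiable_iff.2 isInvariantHolomorphic_jInv.2) h0
  have h1 : serreDerivative ((0 : ℤ) : ℂ) jInv = normalizedDerivOfComplex jInv := by
    ext τ
    simp [serreDerivative_apply]
  rwa [h1, zero_add] at this

theorem lamTerm_S_smul (x : ℂ) (τ : ℍ) :
    lamTerm x (ModularGroup.S • τ) = (τ : ℂ) ^ 2 * lamTerm x τ := by
  have h := congrFun (normalizedDeriv_jInv_slash ModularGroup.S) τ
  have hτ : (τ : ℂ) ≠ 0 := τ.ne_zero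
  rw [ModularForm.SL_slash_apply, ModularGroup.denom_S] at h
  rw [lamTerm_eq, lamTerm_eq, isInvariantHolomorphic_jInv.1, ← h]
  rw [zpow_neg, zpow_ofNat]
  field_simp

theorem tendsto_qParam_atImInfty_nhdsNE :
    Tendsto (fun τ : ℍ => Function.Periodic.qParam 1 (τ : ℂ)) atImInfty (𝓝[≠] 0) :=
  (Function.Periodic.qParam_tendsto one_pos).comp tendsto_coe_atImInfty

theorem eventually_normalizedDeriv_jInv {u : ℂ → ℂ} (hu : HasCuspForm jInv u) :
    ∀ᶠ τ : ℍ in atImInfty, Derivative.normalizedDerivOfComplex jInv τ =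
      deriv u (Function.Periodic.qParam 1 τ) -
        u (Function.Periodic.qParam 1 τ) / Function.Periodic.qParam 1 τ := by
  obtain ⟨A, hA⟩ := (atImInfty_mem _).1 hu.2.2
  have hd : ∀ᶠ q in 𝓝[≠] (0 : ℂ), AnalyticAt ℂ u q :=
    hu.1.eventually_analyticAt.filter_mono nhdsWithin_le_nhds
  have hA' : ∀ᶠ τ : ℍ in atImInfty, A < τ.im := (atImInfty_mem _).2
    ⟨A + 1, fun τ hτ => by simp only [Set.mem_ofPred_eq]; linarith⟩
  filter_upwards [tendsto_qParam_atImInfty_nhdsNE.eventually hd, hA'] with τ h1 h2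
  have h3 : (jInv ∘ ofComplex) =ᶠ[𝓝 (τ : ℂ)]
      fun z => u (Function.Periodic.qParam 1 z) / Function.Periodic.qParam 1 z := by
    have : ∀ᶠ z : ℂ in 𝓝 (τ : ℂ), A < z.im ∧ 0 < z.im :=
      (Complex.continuous_im.continuousAt.eventually (lt_mem_nhds (a := A) h2)).and
        (Complex.continuous_im.continuousAt.eventually (lt_mem_nhds (a := 0) τ.im_pos))
    filter_upwards [this] with z hz
    have := hA ⟨z, hz.2⟩ hz.1.le
    simp only [Set.mem_ofPred_eq] at this
    simp only [Function.comp, ofComplex_apply_of_im_pos hz.2, this]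
  have hq : HasDerivAt (Function.Periodic.qParam 1)
      (Function.Periodic.qParam 1 τ * (2 * Real.pi * Complex.I)) (τ : ℂ) := by
    have := ((hasDerivAt_id (τ : ℂ)).const_mul (2 * Real.pi * Complex.I)).cexp
    have h : Function.Periodic.qParam 1 = fun z : ℂ => cexp (2 * Real.pi * Complex.I * z) := by
      ext z
      simp [Function.Periodic.qParam]
    simpa [h] using this
  have hq0 : Function.Periodic.qParam 1 (τ : ℂ) ≠ 0 := Function.Periodic.qParam_ne_zero _
  have h4 := (h1.differentiableAt.hasDerivAt.comp (τ : ℂ) hq).div hq hq0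
  rw [Derivative.normalizedDerivOfComplex, h3.deriv_eq]
  refine (congrArg _ h4.deriv).trans ?_
  have : (2 * Real.pi * Complex.I : ℂ) ≠ 0 := Complex.two_pi_I_ne_zero
  simp only [Function.comp]
  field_simp

theorem eventually_lamTerm {u : ℂ → ℂ} (hu : HasCuspForm jInv u) (x : ℂ) :
    ∀ᶠ τ : ℍ in atImInfty, lamTerm x τ =
      (fun q => (u q - q * deriv u q) / (u q - x * q)) (Function.Periodic.qParam 1 τ) := by
  filter_upwards [eventually_normalizedDeriv_jInv hu, hu.2.2] with τ h1 h2
  have hq0 : Function.Periodic.qParam 1 (τ : ℂ) ≠ 0 := Function.Periodic.qParam_ne_zero _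
  rw [lamTerm_eq, h1, h2]
  rw [← mul_div_mul_left _ _ hq0]
  congr 1 <;> field_simp
  ring

theorem analyticAt_cuspLogDeriv {u : ℂ → ℂ} (hu : AnalyticAt ℂ u 0) (hu0 : u 0 = 1) (x : ℂ) :
    AnalyticAt ℂ (fun q => (u q - q * deriv u q) / (u q - x * q)) 0 :=
  (hu.sub (analyticAt_id.mul hu.deriv)).div (hu.sub (analyticAt_const.mul analyticAt_id))
    (by simp [hu0])

/-- Near a point of `ℍ`, `lamTerm x` has at most a simple pole. -/
theorem lamTerm_local (x : ℂ) {z₀ : ℂ} (hz₀ : 0 < z₀.im) : ∃ (r : ℂ) (h : ℂ → ℂ),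
    AnalyticAt ℂ h z₀ ∧ ∀ᶠ z in 𝓝[≠] z₀, lamTerm x (ofComplex z) = r / (z - z₀) + h z := by
  set G : ℂ → ℂ := fun z => jInv (ofComplex z) - x with hG
  have hGa : AnalyticAt ℂ G z₀ := (analyticAt_jInv hz₀).sub analyticAt_const
  have him : ∀ᶠ z : ℂ in 𝓝 z₀, 0 < z.im :=
    Complex.continuous_im.continuousAt.eventually (lt_mem_nhds (a := 0) hz₀)
  -- If j - x vanished identically near the point, division by zero would make `lamTerm x` zero
  -- there. The claim then holds trivially, and no appeal to nonconstancy of j is needed.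
  by_cases hz : ∀ᶠ z in 𝓝 z₀, G z = 0
  · refine ⟨0, 0, analyticAt_const, ?_⟩
    filter_upwards [nhdsWithin_le_nhds hz, nhdsWithin_le_nhds him] with z h1 h2
    rw [lamTerm, ← hG, logDeriv_apply, ofComplex_apply_of_im_pos h2]
    simp [h1]
  · obtain ⟨n, g, hg, hg0, hGg⟩ := hGa.exists_eventuallyEq_pow_smul_nonzero_iff.2 hz
    refine ⟨-(1 / (2 * Real.pi * Complex.I)) * n,
      fun z => -(1 / (2 * Real.pi * Complex.I)) * (deriv g z / g z),
      analyticAt_const.mul (hg.deriv.div hg hg0), ?_⟩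
    filter_upwards [nhdsWithin_le_nhds hGg.eventually_nhds, nhdsWithin_le_nhds him,
      nhdsWithin_le_nhds (hg.continuousAt.eventually_ne hg0),
      nhdsWithin_le_nhds hg.eventually_analyticAt, self_mem_nhdsWithin] with z h1 h2 h3 h4 h5
    have h5 : z - z₀ ≠ 0 := sub_ne_zero.2 h5
    have h6 : G =ᶠ[𝓝 z] fun z => (z - z₀) ^ n * g z := h1
    rw [lamTerm, ← hG, ofComplex_apply_of_im_pos h2]
    change _ * logDeriv G z = _
    rw [logDeriv_apply, h6.deriv_eq, h6.eq_of_nhds, ← logDeriv_apply (fun z => (z - z₀) ^ n * g z),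
      logDeriv_mul (f := fun z => (z - z₀) ^ n) z (pow_ne_zero _ h5) h3 (by fun_prop)
        h4.differentiableAt,
      logDeriv_fun_pow (by fun_prop), logDeriv_apply, logDeriv_apply, deriv_sub_const]
    simp
    ring

/-! ### Meromorphic modular forms -/

theorem exists_modularForm_of_tendsto {k : ℤ} {f : ℍ → ℂ}
    (hf : ∀ γ : SL(2, ℤ), f ∣[k] γ = f) (hd : DifferentiableOn ℂ (f ∘ ofComplex) {z : ℂ | 0 < z.im})
    {c : ℂ} (hc : Tendsto f atImInfty (𝓝 c)) : ∃ F : ModularForm 𝒮ℒ k, ⇑F = f :=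
  ⟨{ toFun := f
     slash_action_eq' := by
        rintro _ ⟨γ, rfl⟩
        exact hf γ
     holo' := UpperHalfPlane.mdifferentiable_iff.2 hd
     bdd_at_cusps' := by
        intro c' hc'
        rw [Subgroup.IsArithmetic.isCusp_iff_isCusp_SL2Z] at hc'
        rw [OnePoint.isBoundedAt_iff_forall_SL2Z hc']
        intro γ _
        rw [hf]
        exact hc.isBigO_one ℝ }, rfl⟩

open ModularForm in
theorem tendsto_discriminant_div_qParam :
    Tendsto (fun τ : ℍ => discriminant τ / Function.Periodic.qParam 1 τ) atImInfty (𝓝 1) := by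
  refine tendsto_atImInfty_tprod_one_sub_eta_q_pow.congr fun τ => ?_
  rw [discriminant_eq_q_prod, mul_div_cancel_left₀ _ (Function.Periodic.qParam_ne_zero _)]

open ModularForm in
-- Δ is asymptotic to q, so it cancels a simple pole at the cusp and turns the leading coefficient
-- into the value there.
theorem exists_modularForm_discriminant_mul (k : ℤ) {f : ℍ → ℂ} (hf : ∀ γ : SL(2, ℤ), f ∣[k] γ = f)
    (hd : DifferentiableOn ℂ (f ∘ ofComplex) {z : ℂ | 0 < z.im}) {v : ℂ → ℂ}
    (hv : ContinuousAt v 0)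
    (hfv : ∀ᶠ τ : ℍ in atImInfty, f τ = v (Function.Periodic.qParam 1 τ) /
      Function.Periodic.qParam 1 τ) :
    ∃ F : ModularForm 𝒮ℒ (12 + k), (∀ τ, F τ = discriminant τ * f τ) ∧
      Tendsto F atImInfty (𝓝 (v 0)) := by
  have ht : Tendsto (fun τ => discriminant τ * f τ) atImInfty (𝓝 (v 0)) := by
    have h1 := tendsto_discriminant_div_qParam.mul
      (hv.tendsto.comp (qParam_tendsto_atImInfty one_pos))
    rw [one_mul] at h1
    refine h1.congr' ?_
    filter_upwards [hfv] with τ h2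
    rw [h2]
    simp only [Function.comp]
    ring
  have hinv (γ : SL(2, ℤ)) : (fun τ => discriminant τ * f τ) ∣[12 + k] γ =
      fun τ => discriminant τ * f τ := by
    have := mul_slash_SL2 12 k γ (CuspForm.discriminant : ℍ → ℂ) f
    have hγ : (γ : GL (Fin 2) ℝ) ∈ 𝒮ℒ := ⟨γ, rfl⟩
    have hΔ : ⇑CuspForm.discriminant ∣[(12 : ℤ)] γ = ⇑CuspForm.discriminant :=
      SlashInvariantForm.slash_action_eqn CuspForm.discriminant _ hγ
    rw [hf, hΔ] at this
    exact this
  obtain ⟨F, hF⟩ := exists_modularForm_of_tendsto (k := 12 + k) hinv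
    ((UpperHalfPlane.mdifferentiable_iff.1 CuspForm.discriminant.holo').mul hd) ht
  exact ⟨F, fun τ => congrFun hF τ, by rwa [hF]⟩

open ModularForm in
theorem exists_quotient_lamTerm (x : ℂ) : ∃ (N : ModularForm 𝒮ℒ 14) (M : ModularForm 𝒮ℒ 12),
    Tendsto M atImInfty (𝓝 1) ∧ ∀ τ, lamTerm x τ = N τ / M τ := by
  obtain ⟨u, hu⟩ := exists_hasCuspForm_jInv
  have hD : DifferentiableOn ℂ (Derivative.normalizedDerivOfComplex jInv ∘ ofComplex)
      {z : ℂ | 0 < z.im} :=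
    UpperHalfPlane.mdifferentiable_iff.1 (Derivative.normalizedDerivOfComplex_mdifferentiable
      (UpperHalfPlane.mdifferentiable_iff.2 isInvariantHolomorphic_jInv.2))
  obtain ⟨N, hN, -⟩ := exists_modularForm_discriminant_mul 2 normalizedDeriv_jInv_slash hD
    (v := fun q => q * deriv u q - u q)
    ((continuousAt_id.mul hu.1.deriv.continuousAt).sub hu.1.continuousAt) (by
      filter_upwards [eventually_normalizedDeriv_jInv hu] with τ hτ
      have hq0 : Function.Periodic.qParam 1 (τ : ℂ) ≠ 0 := Function.Periodic.qParam_ne_zero _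
      rw [hτ]
      field_simp)
  obtain ⟨M, hM, hM1⟩ := exists_modularForm_discriminant_mul 0 (f := fun τ => jInv τ - x)
    (fun γ => by
      ext τ
      simp only [ModularForm.SL_slash_apply, isInvariantHolomorphic_jInv.1, neg_zero, zpow_zero,
        mul_one])
    (isInvariantHolomorphic_jInv.2.sub_const x) (v := fun q => u q - x * q)
    (hu.1.continuousAt.sub (continuousAt_const.mul continuousAt_id)) (by
      filter_upwards [hu.2.2] with τ hτ
      have hq0 : Function.Periodic.qParam 1 (τ : ℂ) ≠ 0 := Function.Periodic.qParam_ne_zero _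
      rw [hτ]
      field_simp)
  refine ⟨-N, M, by simpa [hu.2.1] using hM1, fun τ => ?_⟩
  have h1 : (-N) τ = -(discriminant τ * Derivative.normalizedDerivOfComplex jInv τ) := by
    rw [← hN]; rfl
  have h2 : M τ = discriminant τ * (jInv τ - x) := hM τ
  rw [h1, h2, lamTerm_eq, ← mul_neg, mul_div_mul_left _ _ (discriminant_ne_zero τ)]

/-- Fractions are added over the product of the denominators. The normalisation that denominators
tend to 1 at the cusp passes to products and ensures that the common denominator is not identically
zero. -/
theorem exists_quotient_sum_lamTerm {ι : Type*} (s : Finset ι) (c x : ι → ℂ) :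
    ∃ (k : ℤ) (N : ModularForm 𝒮ℒ (k + 2)) (M : ModularForm 𝒮ℒ k), Tendsto M atImInfty (𝓝 1) ∧
      ∀ τ, M τ ≠ 0 → ∑ i ∈ s, c i * lamTerm (x i) τ = N τ / M τ := by
  classical
  induction s using Finset.induction_on with
  | empty =>
    exact ⟨0, 0, 1, tendsto_const_nhds, fun τ _ => by simp⟩
  | insert i s hi ih =>
    obtain ⟨k, N, M, hM, h⟩ := ih
    obtain ⟨N', M', hM', h'⟩ := exists_quotient_lamTerm (x i)
    refine ⟨12 + k, ModularForm.mcast (by ring) (N'.mul (c i • M)) +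
      ModularForm.mcast (by ring) (M'.mul N), M'.mul M, ?_, fun τ hτ => ?_⟩
    · have := hM'.mul hM
      rwa [one_mul] at this
    · have h0 : M' τ * M τ ≠ 0 := hτ
      rw [Finset.sum_insert hi, h τ (right_ne_zero_of_mul h0), h' τ]
      have h1 : M' τ ≠ 0 := left_ne_zero_of_mul h0
      have h2 : M τ ≠ 0 := right_ne_zero_of_mul h0
      change _ = (N' τ * (c i * M τ) + M' τ * N τ) / (M' τ * M τ)
      field_simp

theorem isMeromorphicModularForm_sum_lamTerm {ι : Type*} (s : Finset ι) (c x : ι → ℂ) :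
    IsMeromorphicModularForm 2 fun τ => ∑ i ∈ s, c i * lamTerm (x i) τ := by
  obtain ⟨k, N, M, hM, h⟩ := exists_quotient_sum_lamTerm s c x
  refine ⟨k + 2, k, N, M, ?_, by ring, h⟩
  rintro rfl
  have : Tendsto (fun _ : ℍ => (0 : ℂ)) atImInfty (𝓝 1) := hM
  exact zero_ne_one (tendsto_nhds_unique tendsto_const_nhds this)

/-! ### Finiteness of the set of classes -/

theorem IntForm.equivalent_translate (a b c k : ℤ) :
    IntForm.Equivalent ⟨a, b, c⟩ ⟨a, b - 2 * a * k, a * k ^ 2 - b * k + c⟩ := by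
  refine ⟨⟨!![1, -k; 0, 1], by simp⟩, fun x y => ?_⟩
  simp [IntForm.eval]
  ring

theorem IntForm.equivalent_swap (a b c : ℤ) : IntForm.Equivalent ⟨a, b, c⟩ ⟨c, -b, a⟩ := by
  refine ⟨⟨!![0, -1; 1, 0], by simp⟩, fun x y => ?_⟩
  simp [IntForm.eval]
  ring

/-- Gauss reduction: a translation brings b into [-a, a], and if then c < a, the swap strictly
lowers the leading coefficient. The induction is on a bound for that coefficient. -/
theorem exists_reduced {d : ℕ} (hd : 0 < d) (N : ℕ) : ∀ a b c : ℤ, 0 < a → a ≤ N →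
    b ^ 2 - 4 * a * c = -(d : ℤ) → ∃ a' b' c' : ℤ, 0 < a' ∧ b' ^ 2 - 4 * a' * c' = -(d : ℤ) ∧
      |b'| ≤ a' ∧ a' ≤ c' ∧ IntForm.Equivalent ⟨a, b, c⟩ ⟨a', b', c'⟩ := by
  have hd' : (0 : ℤ) < d := by exact_mod_cast hd
  induction N with
  | zero => intro a b c ha ha'; simp at ha'; omega
  | succ N ih =>
    intro a b c ha haN hdisc
    set k := (b + a) / (2 * a) with hk
    have h1 := IntForm.equivalent_translate a b c k
    set b' := b - 2 * a * k with hb'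
    set c' := a * k ^ 2 - b * k + c with hc'
    have hdisc' : b' ^ 2 - 4 * a * c' = -(d : ℤ) := by rw [← hdisc, hb', hc']; ring
    have hb : |b'| ≤ a := by
      have h2 := Int.emod_add_mul_ediv (b + a) (2 * a)
      have h3 := Int.emod_nonneg (b + a) (b := 2 * a) (by omega)
      have h4 := Int.emod_lt_of_pos (b + a) (b := 2 * a) (by omega)
      rw [← hk] at h2
      rw [abs_le]
      constructor <;> omega
    by_cases hac : a ≤ c'
    · exact ⟨a, b', c', ha, hdisc', hb, hac, h1⟩
    · have hc0 : 0 < c' := by nlinarith [sq_nonneg b']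
      obtain ⟨a₂, b₂, c₂, h2, h3, h4, h5, h6⟩ := ih c' (-b') a hc0 (by push_cast at haN; omega)
        (by rw [← hdisc']; ring)
      exact ⟨a₂, b₂, c₂, h2, h3, h4, h5, (h1.trans (IntForm.equivalent_swap a b' c')).trans h6⟩

theorem finite_formClass {d : ℕ} (hd : 0 < d) : Finite (FormClass d) := by
  have key (C : FormClass d) : ∃ Q : Forms d, (⟦Q⟧ : Quotient (formsSetoid d)) = C ∧
      Q.1.a ∈ Set.Icc (-(d : ℤ)) d ∧ Q.1.b ∈ Set.Icc (-(d : ℤ)) d ∧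
      Q.1.c ∈ Set.Icc (-(d : ℤ)) d := by
    obtain ⟨⟨⟨a, b, c⟩, ha, hdisc⟩, rfl⟩ := Quotient.exists_rep C
    simp only at ha hdisc
    obtain ⟨a', b', c', h1, h2, h3, h4, h5⟩ := exists_reduced hd a.toNat a b c ha (by omega) hdisc
    have h6 := abs_le.1 h3
    -- Hence d = 4 a' c' - b'² ≥ 3 a' c', and all three coefficients of a reduced form are at most d
    -- in absolute value.
    have h7 : b' ^ 2 ≤ a' * c' := by nlinarith [sq_abs b', abs_nonneg b']
    have h8 : a' ≤ a' * c' := by nlinarith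
    have h9 : c' ≤ a' * c' := by nlinarith
    refine ⟨⟨⟨a', b', c'⟩, h1, h2⟩, Quotient.sound h5.symm, ?_⟩
    simp only [Set.mem_Icc]
    refine ⟨⟨?_, ?_⟩, ⟨?_, ?_⟩, ?_, ?_⟩ <;> nlinarith
  choose Q hQ ha hb hc using key
  refine Finite.of_injective (β := Set.Icc (-(d : ℤ)) d × Set.Icc (-(d : ℤ)) d ×
    Set.Icc (-(d : ℤ)) d) (fun C => (⟨_, ha C⟩, ⟨_, hb C⟩, ⟨_, hc C⟩)) fun C C' h => ?_
  simp only [Prod.mk.injEq, Subtype.mk.injEq] at h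
  have : Q C = Q C' := by
    apply Subtype.ext
    obtain ⟨h1, h2, h3⟩ := h
    cases h4 : (Q C).1
    cases h5 : (Q C').1
    simp_all
  rw [← hQ C, this, hQ C']

/-! ### Restriction to the imaginary axis -/

/-- The properties of a weight `2` form with at most simple poles on the imaginary axis on which
the theory of its regularized L-function depends; `c₀` is its value at the cusp. -/
structure IsSimpleAxisForm (f : ℍ → ℂ) (c₀ : ℂ) : Prop where
  local_form : ∀ t : ℝ, 0 < t → ∃ (r : ℂ) (h : ℂ → ℂ), AnalyticAt ℂ h (Complex.I * (t : ℂ)) ∧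
    ∀ᶠ z in 𝓝[≠] (Complex.I * (t : ℂ)), f (ofComplex z) = r / (z - Complex.I * (t : ℂ)) + h z
  S_smul : ∀ τ : ℍ, f (ModularGroup.S • τ) = (τ : ℂ) ^ 2 * f τ
  decay : (fun τ => f τ - c₀) =O[atImInfty] fun τ : ℍ => Function.Periodic.qParam 1 (τ : ℂ)

/-- The restriction of `f` to the imaginary axis. -/
def onAxis (f : ℍ → ℂ) (t : ℝ) : ℂ := f (ofComplex (Complex.I * (t : ℂ)))

/-- This links `axisPoles`, defined by meromorphic order, to the nonvanishing of the residue in a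
local form. -/
theorem meromorphicOrderAt_neg_iff_of_simplePole {F h : ℂ → ℂ} {z₀ r : ℂ}
    (hh : AnalyticAt ℂ h z₀) (hF : ∀ᶠ z in 𝓝[≠] z₀, F z = r / (z - z₀) + h z) :
    meromorphicOrderAt F z₀ < 0 ↔ r ≠ 0 := by
  rw [meromorphicOrderAt_congr (show F =ᶠ[𝓝[≠] z₀] fun z => r / (z - z₀) + h z from hF)]
  by_cases hr : r = 0
  · simpa [hr] using hh.meromorphicOrderAt_nonneg
  · have hm : MeromorphicAt (fun z => r / (z - z₀) + h z) z₀ := by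
      have := hh.meromorphicAt
      fun_prop
    have : meromorphicOrderAt (fun z => r / (z - z₀) + h z) z₀ = ((-1 : ℤ) : WithTop ℤ) := by
      rw [meromorphicOrderAt_eq_int_iff hm]
      refine ⟨fun z => r + (z - z₀) * h z, by fun_prop, by simpa using hr, ?_⟩
      filter_upwards [self_mem_nhdsWithin] with z hz
      have : z - z₀ ≠ 0 := sub_ne_zero.2 hz
      simp only [zpow_neg, zpow_one, smul_eq_mul]
      field_simp
    rw [this]
    simp only [ne_eq, hr, not_false_eq_true, iff_true]
    exact_mod_cast (by norm_num : (-1 : ℤ) < 0)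

theorem tendsto_I_mul_ofReal_nhdsNE (t : ℝ) :
    Tendsto (fun s : ℝ => Complex.I * (s : ℂ)) (𝓝[≠] t) (𝓝[≠] (Complex.I * (t : ℂ))) := by
  refine tendsto_nhdsWithin_iff.2 ⟨?_, ?_⟩
  · exact ((continuous_const.mul continuous_ofReal).tendsto t).mono_left nhdsWithin_le_nhds
  · filter_upwards [self_mem_nhdsWithin] with s hs
    simpa using hs

theorem tendsto_ofComplex_I_mul : Tendsto (fun t : ℝ => ofComplex (Complex.I * (t : ℂ))) atTop
    atImInfty := by
  refine tendsto_comap_im_ofComplex.comp (tendsto_comap_iff.2 ?_)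
  refine tendsto_id.congr fun t => ?_
  simp

namespace IsSimpleAxisForm

theorem tendsto_atImInfty (hf : IsSimpleAxisForm f c₀) : Tendsto f atImInfty (𝓝 c₀) := by
  have := hf.decay.trans_tendsto (qParam_tendsto_atImInfty one_pos)
  simpa using this.add_const c₀

theorem valueAtInfty_eq (hf : IsSimpleAxisForm f c₀) : valueAtInfty f = c₀ :=
  hf.tendsto_atImInfty.limUnder_eq

theorem onAxis_decay (hf : IsSimpleAxisForm f c₀) (r : ℝ) :
    (fun t => onAxis f t - c₀) =O[atTop] fun t : ℝ => t ^ r := by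
  have h1 : (fun t => onAxis f t - c₀) =O[atTop] fun t : ℝ => Real.exp (-(2 * Real.pi) * t) := by
    refine (hf.decay.comp_tendsto tendsto_ofComplex_I_mul).trans (.of_norm_eventuallyLE ?_)
    filter_upwards [eventually_gt_atTop 0] with t ht
    have : 0 < (Complex.I * (t : ℂ)).im := by simpa using ht
    simp only [Function.comp, ofComplex_apply_of_im_pos this, Function.Periodic.norm_qParam]
    simp
  exact h1.trans (isLittleO_exp_neg_mul_rpow_atTop (by positivity) r).isBigO

/-- The sign is that of (i t)² in the weight 2 transformation; it becomes the root number -1 of the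
functional equation. -/
theorem onAxis_inv (hf : IsSimpleAxisForm f c₀) {t : ℝ} (ht : 0 < t) :
    onAxis f t⁻¹ = -(t : ℂ) ^ 2 * onAxis f t := by
  have h0 : 0 < (Complex.I * (t : ℂ)).im := by simpa using ht
  have h1 : 0 < (Complex.I * ((t⁻¹ : ℝ) : ℂ)).im := by simpa using ht
  have h := hf.S_smul ⟨_, h0⟩
  have h2 : ModularGroup.S • (⟨Complex.I * (t : ℂ), h0⟩ : ℍ) =
      ⟨Complex.I * ((t⁻¹ : ℝ) : ℂ), h1⟩ := by
    rw [UpperHalfPlane.modular_S_smul]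
    ext
    simp [mul_comm]
  rw [onAxis, onAxis, ofComplex_apply_of_im_pos h0, ofComplex_apply_of_im_pos h1, ← h2, h]
  simp [mul_pow]

/-- The local form of `f` on the imaginary axis. -/
theorem onAxis_local (hf : IsSimpleAxisForm f c₀) {t : ℝ} (ht : 0 < t) :
    ∃ (ρ : ℂ) (k : ℝ → ℂ), (∀ᶠ s in 𝓝 t, ContinuousAt k s) ∧
      (∀ᶠ s in 𝓝[≠] t, onAxis f s = ρ / ((s : ℂ) - t) + k s) ∧ (ρ ≠ 0 ↔ t ∈ axisPoles f) := by
  obtain ⟨r, h, hh, hr⟩ := hf.local_form t ht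
  have hc : Tendsto (fun s : ℝ => Complex.I * (s : ℂ)) (𝓝 t) (𝓝 (Complex.I * (t : ℂ))) :=
    (continuous_const.mul continuous_ofReal).tendsto t
  refine ⟨r / Complex.I, fun s => h (Complex.I * (s : ℂ)), ?_, ?_, ?_⟩
  · filter_upwards [hc.eventually hh.eventually_analyticAt] with s hs
    exact ContinuousAt.comp (f := fun s : ℝ => Complex.I * (s : ℂ)) hs.continuousAt
      (continuous_const.mul continuous_ofReal).continuousAt
  · filter_upwards [(tendsto_I_mul_ofReal_nhdsNE t).eventually hr] with s hs
    rw [onAxis, hs, div_div, mul_sub]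
  · have := meromorphicOrderAt_neg_iff_of_simplePole (F := f ∘ ofComplex) hh hr
    simp only [axisPoles, Set.mem_ofPred_eq, this, ht, true_and]
    simp

theorem eventually_notMem_axisPoles (hf : IsSimpleAxisForm f c₀) {t : ℝ} (ht : 0 < t) :
    ∀ᶠ s in 𝓝[≠] t, s ∉ axisPoles f := by
  obtain ⟨r, h, hh, hr⟩ := hf.local_form t ht
  have hr' := eventually_nhdsWithin_iff.1 hr
  have h1 : ∀ᶠ z in 𝓝[≠] (Complex.I * (t : ℂ)),
      z ∉ {z | meromorphicOrderAt (f ∘ ofComplex) z < 0} := by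
    filter_upwards [nhdsWithin_le_nhds hr'.eventually_nhds, nhdsWithin_le_nhds
      hh.eventually_analyticAt, self_mem_nhdsWithin] with z h2 h3 h4
    have h4 : z ≠ Complex.I * (t : ℂ) := h4
    have h5 : (f ∘ ofComplex) =ᶠ[𝓝 z] fun z => r / (z - Complex.I * (t : ℂ)) + h z := by
      filter_upwards [h2, isOpen_ne.mem_nhds h4] with w h6 h7
      exact h6 h7
    have h6 : AnalyticAt ℂ (f ∘ ofComplex) z := by
      refine AnalyticAt.congr ?_ h5.symm
      have : z - Complex.I * (t : ℂ) ≠ 0 := sub_ne_zero.2 h4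
      fun_prop (disch := assumption)
    simpa using h6.meromorphicOrderAt_nonneg
  filter_upwards [(tendsto_I_mul_ofReal_nhdsNE t).eventually h1] with s hs hs'
  exact hs hs'.2

theorem not_bounded_of_mem_axisPoles (hf : IsSimpleAxisForm f c₀) {t : ℝ} (ht : t ∈ axisPoles f)
    {B : ℝ} (hB : ∀ᶠ s in 𝓝 t, ‖onAxis f s‖ ≤ B) : False := by
  obtain ⟨ρ, k, hk, hρ, hm⟩ := hf.onAxis_local ht.1
  have h1 : Tendsto (fun s : ℝ => ((s : ℂ) - t) * onAxis f s) (𝓝[≠] t) (𝓝 ρ) := by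
    have h2 : Tendsto (fun s : ℝ => ρ + ((s : ℂ) - t) * k s) (𝓝 t) (𝓝 (ρ + ((t : ℂ) - t) * k t)) :=
      tendsto_const_nhds.add (((continuous_ofReal.tendsto t).sub_const _).mul
        hk.self_of_nhds)
    simp only [sub_self, zero_mul, add_zero] at h2
    refine (h2.mono_left nhdsWithin_le_nhds).congr' ?_
    filter_upwards [hρ, self_mem_nhdsWithin] with s h3 h4
    have : (s : ℂ) - t ≠ 0 := sub_ne_zero.2 (by exact_mod_cast h4)
    rw [h3]
    field_simp
  have h2 : Tendsto (fun s : ℝ => ((s : ℂ) - t) * onAxis f s) (𝓝[≠] t) (𝓝 0) := by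
    have h3 : Tendsto (fun s : ℝ => ((s : ℂ) - t)) (𝓝[≠] t) (𝓝 0) := by
      have := ((continuous_ofReal.tendsto t).sub_const (t : ℂ)).mono_left
        (nhdsWithin_le_nhds (s := {t}ᶜ))
      simpa using this
    refine h3.zero_mul_isBoundedUnder_le ?_
    exact ⟨B, eventually_map.2 (nhdsWithin_le_nhds hB)⟩
  exact hm.2 ht (tendsto_nhds_unique h1 h2)

/-- Convergence at the cusp bounds f high on the axis, and inversion bounds it near any given point
close to 0. The poles thus lie in a compact interval [1 / Y, Y], where they cannot accumulate
because they are isolated. -/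
theorem finite_axisPoles (hf : IsSimpleAxisForm f c₀) : (axisPoles f).Finite := by
  have h1 := (hf.tendsto_atImInfty.comp tendsto_ofComplex_I_mul).norm
  obtain ⟨Y, hY⟩ := eventually_atTop.1 ((h1.eventually_lt_const (lt_add_one ‖c₀‖)).and
    (eventually_gt_atTop 1))
  have hb (s : ℝ) (hs : Y ≤ s) : ‖onAxis f s‖ ≤ ‖c₀‖ + 1 := (hY s hs).1.le
  have hY1 : 1 < Y := (hY Y le_rfl).2
  have hsub : axisPoles f ⊆ Set.Icc Y⁻¹ Y := by
    intro t ht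
    have ht0 := ht.1
    by_contra hcon
    rw [Set.mem_Icc, not_and_or, not_le, not_le] at hcon
    rcases hcon with h2 | h2
    -- For s > t / 2 the factor s⁻² in f(i s) = -s⁻² f(i / s) is at most (2 / t)², and i / s lies
    -- high on the axis.
    · refine hf.not_bounded_of_mem_axisPoles ht (B := (2 / t) ^ 2 * (‖c₀‖ + 1)) ?_
      filter_upwards [lt_mem_nhds (half_lt_self ht0), gt_mem_nhds h2] with s h3 h4
      have hs0 : 0 < s := by linarith
      have h5 := hf.onAxis_inv (t := s⁻¹) (by positivity)
      rw [inv_inv] at h5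
      rw [h5, norm_mul, norm_neg, norm_pow]
      have h6 : ‖((s⁻¹ : ℝ) : ℂ)‖ ≤ 2 / t := by
        rw [Complex.norm_real, Real.norm_of_nonneg (by positivity),
          inv_le_comm₀ hs0 (by positivity)]
        rw [inv_div]; exact h3.le
      have h7 := hb s⁻¹ (by rw [le_inv_comm₀ (by linarith) hs0]; exact h4.le)
      gcongr
    · exact hf.not_bounded_of_mem_axisPoles ht (B := ‖c₀‖ + 1)
        (by filter_upwards [lt_mem_nhds h2] with s hs using hb s hs.le)
  by_contra hinf
  obtain ⟨t, ht, hacc⟩ := Set.Infinite.exists_accPt_of_subset_isCompact hinf isCompact_Icc hsub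
  have ht0 : 0 < t := lt_of_lt_of_le (by positivity) ht.1
  rw [accPt_iff_frequently_nhdsNE] at hacc
  exact hacc (by simpa using hf.eventually_notMem_axisPoles ht0)

end IsSimpleAxisForm

/-! ### A truncated Cauchy kernel -/

/-- The truncated kernel `max (1 - u² / δ²) 0 / u`. -/
def truncKernel (δ u : ℝ) : ℝ := max (1 - u ^ 2 / δ ^ 2) 0 / u

theorem truncKernel_neg (δ u : ℝ) : truncKernel δ (-u) = -truncKernel δ u := by
  simp [truncKernel, div_neg]

theorem truncKernel_eq_zero {δ u : ℝ} (hδ : 0 < δ) (hu : δ ≤ |u|) : truncKernel δ u = 0 := by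
  have : 1 ≤ u ^ 2 / δ ^ 2 := by
    rw [one_le_div (by positivity), ← sq_abs u]
    gcongr
  rw [truncKernel, max_eq_right (by linarith), zero_div]

theorem truncKernel_eq {δ u : ℝ} (hδ : 0 < δ) (hu : |u| < δ) (hu0 : u ≠ 0) :
    truncKernel δ u = 1 / u - u / δ ^ 2 := by
  have : u ^ 2 / δ ^ 2 ≤ 1 := by
    rw [div_le_one (by positivity), ← sq_abs u]
    gcongr
  rw [truncKernel, max_eq_left (by linarith)]
  field_simp

theorem abs_truncKernel_le (δ u : ℝ) : |truncKernel δ u| ≤ |u|⁻¹ := by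
  rw [truncKernel, abs_div, div_eq_mul_inv]
  refine mul_le_of_le_one_left (by positivity) ?_
  rw [abs_of_nonneg (le_max_right _ _)]
  exact max_le (by linarith [show 0 ≤ u ^ 2 / δ ^ 2 by positivity]) zero_le_one

theorem measurable_truncKernel (δ : ℝ) : Measurable (truncKernel δ) := by
  unfold truncKernel
  fun_prop

theorem continuousAt_truncKernel (δ : ℝ) {u : ℝ} (hu : u ≠ 0) :
    ContinuousAt (truncKernel δ) u := by
  unfold truncKernel
  fun_prop (disch := assumption)

/-- The finite part of the Mellin transform of the truncated kernel at `p`. -/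
def kernelMellin (p δ : ℝ) (s : ℂ) : ℂ :=
  ∫ t in Set.Icc (p - δ) (p + δ), ((t : ℂ) ^ (s - 1) - (p : ℂ) ^ (s - 1)) *
    (truncKernel δ (t - p) : ℂ)

/-- By the mean value inequality, the difference vanishes to first order at p, locally uniformly in
s. This compensates the singularity of the kernel. -/
theorem exists_bound_cpow_sub_cpow {a b p : ℝ} (ha : 0 < a) (hp : p ∈ Set.Icc a b) (s₀ : ℂ) :
    ∃ B : ℝ, 0 ≤ B ∧ ∀ s ∈ Metric.closedBall s₀ 1, ∀ t ∈ Set.Icc a b,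
      ‖(t : ℂ) ^ (s - 1) - (p : ℂ) ^ (s - 1)‖ ≤ B * |t - p| := by
  have hcont : ContinuousOn (fun x : ℂ × ℝ => (x.1 - 1) * (x.2 : ℂ) ^ (x.1 - 1 - 1))
      (Metric.closedBall s₀ 1 ×ˢ Set.Icc a b) := by
    refine ContinuousOn.mul (by fun_prop) (ContinuousOn.cpow (by fun_prop) (by fun_prop) ?_)
    rintro ⟨s, t⟩ ⟨-, ht⟩
    exact Or.inl (by simpa using ha.trans_le ht.1)
  obtain ⟨B, hB⟩ := ((isCompact_closedBall s₀ 1).prod isCompact_Icc).exists_bound_of_continuousOn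
    hcont
  refine ⟨max B 0, le_max_right _ _, fun s hs t ht => ?_⟩
  have hd : ∀ v ∈ Set.Icc a b, HasDerivWithinAt (fun v : ℝ => (v : ℂ) ^ (s - 1))
      ((s - 1) * (v : ℂ) ^ (s - 1 - 1)) (Set.Icc a b) v := by
    intro v hv
    have hv0 : 0 < v := ha.trans_le hv.1
    have := ((hasDerivAt_id (v : ℂ)).cpow_const (c := s - 1) (Or.inl (by simpa using hv0)))
    simpa using this.comp_ofReal.hasDerivWithinAt
  have := (convex_Icc a b).norm_image_sub_le_of_norm_hasDerivWithin_le hd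
    (fun v hv => (hB (s, v) ⟨hs, hv⟩).trans (le_max_left B 0)) hp ht
  simpa using this

theorem norm_kernel_le {p δ : ℝ} {s : ℂ} {B t : ℝ} (hB0 : 0 ≤ B)
    (hB : ‖(t : ℂ) ^ (s - 1) - (p : ℂ) ^ (s - 1)‖ ≤ B * |t - p|) :
    ‖((t : ℂ) ^ (s - 1) - (p : ℂ) ^ (s - 1)) * (truncKernel δ (t - p) : ℂ)‖ ≤ B := by
  rw [norm_mul, Complex.norm_real, Real.norm_eq_abs]
  by_cases h : t - p = 0
  · simp [truncKernel, h, hB0]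
  · have h' : 0 < |t - p| := abs_pos.2 h
    calc _ ≤ (B * |t - p|) * |t - p|⁻¹ :=
          mul_le_mul hB (abs_truncKernel_le _ _) (abs_nonneg _) (by positivity)
      _ = B := by field_simp

theorem measurable_kernel (p δ : ℝ) (s : ℂ) : Measurable fun t : ℝ =>
    ((t : ℂ) ^ (s - 1) - (p : ℂ) ^ (s - 1)) * (truncKernel δ (t - p) : ℂ) := by
  have := (measurable_truncKernel δ).comp (measurable_id.sub_const p)
  have h2 : Measurable fun t : ℝ => (truncKernel δ (t - p) : ℂ) := measurable_ofReal.comp this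
  have h1 : Measurable fun t : ℝ => (t : ℂ) ^ (s - 1) := by fun_prop
  exact (h1.sub_const _).mul h2

theorem integrableOn_kernel {p δ : ℝ} (hδ : 0 < δ) (hp : δ < p) (s : ℂ) :
    IntegrableOn (fun t : ℝ => ((t : ℂ) ^ (s - 1) - (p : ℂ) ^ (s - 1)) *
      (truncKernel δ (t - p) : ℂ)) (Set.Icc (p - δ) (p + δ)) := by
  obtain ⟨B, hB0, hB⟩ := exists_bound_cpow_sub_cpow (a := p - δ) (b := p + δ) (p := p)
    (by linarith) ⟨by linarith, by linarith⟩ s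
  refine Measure.integrableOn_of_bounded (M := B) (by simp)
    (measurable_kernel p δ s).aestronglyMeasurable ?_
  filter_upwards [ae_restrict_mem measurableSet_Icc] with t ht
  exact norm_kernel_le hB0 (hB s (by simp) t ht)

theorem differentiable_kernelMellin {p δ : ℝ} (hδ : 0 < δ) (hp : δ < p) :
    Differentiable ℂ (kernelMellin p δ) := by
  intro s₀
  have hp0 : 0 < p := hδ.trans hp
  obtain ⟨B, hB0, hB⟩ := exists_bound_cpow_sub_cpow (a := p - δ) (b := p + δ) (p := p)
    (by linarith) ⟨by linarith, by linarith⟩ s₀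
  have hder (t : ℝ) (ht : 0 < t) (s : ℂ) : HasDerivAt (fun s : ℂ =>
      ((t : ℂ) ^ (s - 1) - (p : ℂ) ^ (s - 1)) * (truncKernel δ (t - p) : ℂ))
      (((t : ℂ) ^ (s - 1) * Complex.log t - (p : ℂ) ^ (s - 1) * Complex.log p) *
        (truncKernel δ (t - p) : ℂ)) s := by
    have h1 := ((hasDerivAt_id s).sub_const (1 : ℂ)).const_cpow (c := (t : ℂ))
      (Or.inl (by exact_mod_cast ht.ne'))
    have h2 := ((hasDerivAt_id s).sub_const (1 : ℂ)).const_cpow (c := (p : ℂ))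
      (Or.inl (by exact_mod_cast hp0.ne'))
    simpa using (h1.sub h2).mul_const (truncKernel δ (t - p) : ℂ)
  refine (hasDerivAt_integral_of_dominated_loc_of_deriv_le (𝕜 := ℂ)
    (μ := volume.restrict (Set.Icc (p - δ) (p + δ)))
    (F := fun (s : ℂ) (t : ℝ) => ((t : ℂ) ^ (s - 1) - (p : ℂ) ^ (s - 1)) *
      (truncKernel δ (t - p) : ℂ)) (x₀ := s₀)
    (F' := fun (s : ℂ) (t : ℝ) =>
      ((t : ℂ) ^ (s - 1) * Complex.log t - (p : ℂ) ^ (s - 1) * Complex.log p) *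
        (truncKernel δ (t - p) : ℂ)) (bound := fun _ => B / (1 / 2))
    (Metric.ball_mem_nhds s₀ (ε := 1 / 2) (by norm_num))
    (.of_forall fun s => (measurable_kernel p δ s).aestronglyMeasurable)
    (integrableOn_kernel hδ hp s₀) ?_ ?_ (integrable_const _) ?_).2.differentiableAt
  · have := (measurable_truncKernel δ).comp (measurable_id.sub_const p)
    have h2 : Measurable fun t : ℝ => (truncKernel δ (t - p) : ℂ) := measurable_ofReal.comp this
    have h1 : Measurable fun t : ℝ => (t : ℂ) ^ (s₀ - 1) * Complex.log t := by fun_prop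
    exact ((h1.sub_const _).mul h2).aestronglyMeasurable
  · filter_upwards [ae_restrict_mem measurableSet_Icc] with t ht s hs
    have ht0 : 0 < t := by linarith [ht.1]
    rw [← (hder t ht0 s).deriv]
    refine Complex.norm_deriv_le_of_forall_mem_sphere_norm_le (by norm_num)
      (Differentiable.diffContOnCl fun z => (hder t ht0 z).differentiableAt) fun z hz => ?_
    refine norm_kernel_le hB0 (hB z ?_ t ht)
    rw [mem_sphere_iff_norm] at hz
    rw [Metric.mem_ball, dist_eq_norm] at hs
    rw [Metric.mem_closedBall, dist_eq_norm]
    calc ‖z - s₀‖ = ‖(z - s) + (s - s₀)‖ := by ring_nf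
      _ ≤ _ := (norm_add_le _ _).trans (by linarith)
  · filter_upwards [ae_restrict_mem measurableSet_Icc] with t ht s hs
    exact hder t (by linarith [ht.1]) s

/-- The kernel is odd, so that its integral over a symmetric set vanishes. -/
theorem setIntegral_truncKernel_eq_zero (p δ ε : ℝ) :
    ∫ t in {t : ℝ | ε < |t - p|}, (truncKernel δ (t - p) : ℂ) = 0 := by
  have hm : MeasurableSet {t : ℝ | ε < |t - p|} := measurableSet_lt (by fun_prop) (by fun_prop)
  rw [← integral_indicator hm]
  set F : ℝ → ℂ := Set.indicator {t : ℝ | ε < |t - p|} fun t => (truncKernel δ (t - p) : ℂ) with hF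
  have h1 := integral_sub_left_eq_self F volume (2 * p)
  have h2 : ∀ t, F (2 * p - t) = -F t := by
    intro t
    have h3 : 2 * p - t - p = -(t - p) := by ring
    have h4 : 2 * p - t ∈ {t : ℝ | ε < |t - p|} ↔ t ∈ {t : ℝ | ε < |t - p|} := by
      simp only [Set.mem_ofPred_eq, h3, abs_neg]
    by_cases h5 : t ∈ {t : ℝ | ε < |t - p|}
    · rw [hF, Set.indicator_of_mem h5, Set.indicator_of_mem (h4.2 h5), h3, truncKernel_neg]
      simp
    · rw [hF, Set.indicator_of_notMem h5, Set.indicator_of_notMem (mt h4.1 h5), neg_zero]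
  simp only [h2, integral_neg] at h1
  exact self_eq_neg.1 h1.symm

/-! ### Functions which are continuous up to isolated points -/

/-- Near `t`, and away from `t`, the function `k` agrees with a continuous function. -/
def IsRegularAt (k : ℝ → ℂ) (t : ℝ) : Prop :=
  ∃ k' : ℝ → ℂ, (∀ᶠ s in 𝓝 t, ContinuousAt k' s) ∧ k =ᶠ[𝓝[≠] t] k'

theorem IsRegularAt.integrableAtFilter {k : ℝ → ℂ} {t : ℝ} (h : IsRegularAt k t) :
    IntegrableAtFilter k (𝓝 t) := by
  obtain ⟨k', hk', hkk⟩ := h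
  obtain ⟨ε, hε, h1⟩ := Metric.eventually_nhds_iff_ball.1
    (hk'.and (eventually_nhdsWithin_iff.1 hkk))
  have hε2 : Metric.closedBall t (ε / 2) ⊆ Metric.ball t ε :=
    Metric.closedBall_subset_ball (by linarith)
  refine ⟨Metric.closedBall t (ε / 2), Metric.closedBall_mem_nhds _ (by positivity), ?_⟩
  have h2 : IntegrableOn k' (Metric.closedBall t (ε / 2)) :=
    ContinuousOn.integrableOn_compact (isCompact_closedBall t _)
      fun s hs => (h1 s (hε2 hs)).1.continuousWithinAt
  refine h2.congr ?_
  filter_upwards [ae_restrict_mem measurableSet_closedBall,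
    ae_restrict_of_ae (Measure.ae_ne volume t)] with s hs hst
  exact ((h1 s (hε2 hs)).2 hst).symm

theorem locallyIntegrableOn_of_isRegularAt {k : ℝ → ℂ} (h : ∀ t, 0 < t → IsRegularAt k t) :
    LocallyIntegrableOn k (Set.Ioi 0) := fun t ht =>
  (h t ht).integrableAtFilter.filter_mono nhdsWithin_le_nhds

theorem IsRegularAt.comp_inv {k : ℝ → ℂ} {t : ℝ} (ht : 0 < t) (h : IsRegularAt k t⁻¹) :
    IsRegularAt (fun s => k s⁻¹) t := by
  obtain ⟨k', hk', hkk⟩ := h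
  have hc : Tendsto (fun s : ℝ => s⁻¹) (𝓝 t) (𝓝 t⁻¹) := (continuousAt_inv₀ ht.ne')
  refine ⟨fun s => k' s⁻¹, ?_, ?_⟩
  · filter_upwards [hc.eventually hk', lt_mem_nhds ht] with s hs hs0
    exact ContinuousAt.comp (f := fun s : ℝ => s⁻¹) hs (continuousAt_inv₀ hs0.ne')
  · have : Tendsto (fun s : ℝ => s⁻¹) (𝓝[≠] t) (𝓝[≠] t⁻¹) := by
      refine tendsto_nhdsWithin_iff.2 ⟨hc.mono_left nhdsWithin_le_nhds, ?_⟩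
      filter_upwards [self_mem_nhdsWithin] with s hs
      simpa using hs
    exact this.eventually hkk

theorem IsRegularAt.continuous_mul {k a : ℝ → ℂ} {t : ℝ} (h : IsRegularAt k t)
    (ha : ∀ᶠ s in 𝓝 t, ContinuousAt a s) : IsRegularAt (fun s => a s * k s) t := by
  obtain ⟨k', hk', hkk⟩ := h
  refine ⟨fun s => a s * k' s, ?_, ?_⟩
  · filter_upwards [hk', ha] with s h1 h2 using h2.mul h1
  · filter_upwards [hkk] with s hs
    rw [hs]

/-- Dominated convergence in the form that serves both limits of the regularization, Λ → ∞ and ε →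
0. -/
theorem tendsto_setIntegral_inter {ι : Type*} {l : Filter ι} [l.IsCountablyGenerated]
    {F : ℝ → ℂ} {E : Set ℝ} {S : ι → Set ℝ} (hF : IntegrableOn F E)
    (hS : ∀ i, MeasurableSet (S i)) (h : ∀ᵐ t ∂volume.restrict E, ∀ᶠ i in l, t ∈ S i) :
    Tendsto (fun i => ∫ t in E ∩ S i, F t) l (𝓝 (∫ t in E, F t)) := by
  have h1 : (fun i => ∫ t in E ∩ S i, F t) = fun i => ∫ t in E, (S i).indicator F t := by
    ext i
    rw [setIntegral_indicator (hS i)]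
  rw [h1]
  refine tendsto_integral_filter_of_dominated_convergence (fun t => ‖F t‖)
    (.of_forall fun i => hF.aestronglyMeasurable.indicator (hS i))
    (.of_forall fun i => .of_forall fun t => norm_indicator_le_norm_self _ _) hF.norm ?_
  filter_upwards [h] with t ht
  refine tendsto_const_nhds.congr' ?_
  filter_upwards [ht] with i hi
  rw [Set.indicator_of_mem hi]

/-! ### The regularized integral -/

/-- With such a δ the kernels are supported in t > 0, and a point within δ of one pole has distance
more than δ from every other. -/
theorem exists_separation {P : Set ℝ} (hP : P.Finite) (hpos : ∀ p ∈ P, 0 < p) :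
    ∃ δ : ℝ, 0 < δ ∧ (∀ p ∈ P, δ < p) ∧ ∀ p ∈ P, ∀ y ∈ P, y ≠ p → 2 * δ < |y - p| := by
  have h1 : ∀ᶠ δ in 𝓝[>] (0 : ℝ), ∀ p ∈ P, δ < p :=
    (hP.eventually_all).2 fun p hp => nhdsWithin_le_nhds (gt_mem_nhds (hpos p hp))
  have h2 : ∀ᶠ δ in 𝓝[>] (0 : ℝ), ∀ p ∈ P, ∀ y ∈ P, y ≠ p → 2 * δ < |y - p| := by
    refine (hP.eventually_all).2 fun p hp => (hP.eventually_all).2 fun y hy => ?_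
    by_cases h : y = p
    · simp [h]
    · have h3 : 0 < |y - p| := abs_pos.2 (sub_ne_zero.2 h)
      filter_upwards [nhdsWithin_le_nhds (gt_mem_nhds (half_pos h3))] with δ hδ _
      linarith
  obtain ⟨δ, h3, h4, h5⟩ := (h1.and (h2.and self_mem_nhdsWithin)).exists
  exact ⟨δ, h5, h3, h4⟩

theorem IsSimpleAxisForm.exists_residue (hf : IsSimpleAxisForm f c₀) : ∃ ρ : ℝ → ℂ,
    (∀ t, 0 < t → ∃ k : ℝ → ℂ, (∀ᶠ s in 𝓝 t, ContinuousAt k s) ∧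
      ∀ᶠ s in 𝓝[≠] t, onAxis f s = ρ t / ((s : ℂ) - t) + k s) ∧
    ∀ t, 0 < t → t ∉ axisPoles f → ρ t = 0 := by
  classical
  refine ⟨fun t => if ht : 0 < t then (hf.onAxis_local ht).choose else 0, fun t ht => ?_,
    fun t ht htP => ?_⟩
  · obtain ⟨k, h1, h2, h3⟩ := (hf.onAxis_local ht).choose_spec
    exact ⟨k, h1, by simpa only [ht, dif_pos] using h2⟩
  · obtain ⟨k, h1, h2, h3⟩ := (hf.onAxis_local ht).choose_spec
    simp only [ht, dif_pos]
    by_contra hcon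
    exact htP (h3.1 hcon)

/-- The polar part of `f` on the imaginary axis. -/
def polarPart (S : Finset ℝ) (ρ : ℝ → ℂ) (δ t : ℝ) : ℂ :=
  ∑ p ∈ S, ρ p * (truncKernel δ (t - p) : ℂ)

/-- Near t the kernel at t is 1 / (s - t) - (s - t) / δ², so the pole cancels and a linear term is
left. The kernels at other poles are continuous near t, except possibly at their own centres. -/
theorem isRegularAt_sub_polarPart {g : ℝ → ℂ} {S : Finset ℝ} {ρ : ℝ → ℂ} {δ t : ℝ} (hδ : 0 < δ)
    (hg : ∃ k : ℝ → ℂ, (∀ᶠ s in 𝓝 t, ContinuousAt k s) ∧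
      ∀ᶠ s in 𝓝[≠] t, g s = ρ t / ((s : ℂ) - t) + k s) (hS : t ∉ S → ρ t = 0) :
    IsRegularAt (fun s => g s - polarPart S ρ δ s) t := by
  obtain ⟨k, hk, hgk⟩ := hg
  refine ⟨fun s => k s + ρ t * ((s : ℂ) - t) / δ ^ 2 - polarPart (S.erase t) ρ δ s, ?_, ?_⟩
  · have h1 : ∀ᶠ s in 𝓝 t, ∀ p ∈ S.erase t, s ≠ p := by
      rw [Finset.eventually_all]
      intro p hp
      exact isOpen_ne.mem_nhds (Finset.ne_of_mem_erase hp).symm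
    filter_upwards [hk, h1] with s h2 h3
    refine (h2.add (by fun_prop)).sub ?_
    unfold polarPart
    refine tendsto_finsetSum _ fun p hp => ?_
    refine tendsto_const_nhds.mul ((continuous_ofReal.tendsto _).comp ?_)
    exact ContinuousAt.comp (f := fun s : ℝ => s - p)
      (continuousAt_truncKernel δ (sub_ne_zero.2 (h3 p hp))) (by fun_prop)
  · have h1 : ∀ᶠ s in 𝓝[≠] t, |s - t| < δ := by
      refine nhdsWithin_le_nhds ?_
      filter_upwards [Metric.ball_mem_nhds t hδ] with s hs
      rwa [Metric.mem_ball, Real.dist_eq] at hs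
    filter_upwards [hgk, h1, self_mem_nhdsWithin] with s h2 h3 h4
    have h5 : s - t ≠ 0 := sub_ne_zero.2 h4
    have h6 : polarPart S ρ δ s = ρ t * (truncKernel δ (s - t) : ℂ) +
        polarPart (S.erase t) ρ δ s := by
      by_cases ht : t ∈ S
      · rw [polarPart, polarPart,
          Finset.add_sum_erase S (fun p => ρ p * (truncKernel δ (s - p) : ℂ)) ht]
      · rw [hS ht, Finset.erase_eq_of_notMem ht]
        ring
    rw [h2, h6, truncKernel_eq hδ h3 h5]
    push_cast
    ring

theorem polarPart_eq_zero {S : Finset ℝ} {ρ : ℝ → ℂ} {δ t : ℝ} (hδ : 0 < δ)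
    (h : ∀ p ∈ S, δ ≤ |t - p|) : polarPart S ρ δ t = 0 :=
  Finset.sum_eq_zero fun p hp => by rw [truncKernel_eq_zero hδ (h p hp)]; simp

/-- The functional equation of `f`, after subtraction of its polar part. -/
def IsSimpleAxisForm.fePair (hf : IsSimpleAxisForm f c₀) (S : Finset ℝ) (ρ : ℝ → ℂ) (δ : ℝ)
    (hδ : 0 < δ) (hSδ : ∀ p ∈ S, δ < p)
    (hreg : ∀ t, 0 < t → IsRegularAt (fun s => onAxis f s - polarPart S ρ δ s) t) :
    WeakFEPair ℂ where
  f t := onAxis f t - polarPart S ρ δ t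
  -- The polar part need not be symmetric under inversion, so g is chosen to make the functional
  -- equation hold by definition. The modularity of f enters in the behaviour of g at infinity,
  -- where the polar part vanishes.
  g t := -((t : ℂ) ^ 2)⁻¹ * (onAxis f t⁻¹ - polarPart S ρ δ t⁻¹)
  k := 2
  ε := -1
  f₀ := c₀
  g₀ := c₀
  hf_int := locallyIntegrableOn_of_isRegularAt hreg
  hg_int := by
    refine locallyIntegrableOn_of_isRegularAt fun t ht => ?_
    refine ((hreg t⁻¹ (inv_pos.2 ht)).comp_inv ht).continuous_mul ?_
    filter_upwards [lt_mem_nhds ht] with s hs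
    have : (s : ℂ) ^ 2 ≠ 0 := pow_ne_zero _ (by exact_mod_cast hs.ne')
    fun_prop (disch := assumption)
  hk := two_pos
  hε := by simp
  h_feq t ht := by
    have : (t : ℂ) ≠ 0 := by exact_mod_cast (ne_of_gt ht)
    rw [one_div, Real.rpow_ofNat, smul_eq_mul]
    push_cast
    field_simp
  hf_top r := by
    refine (hf.onAxis_decay r).congr' ?_ .rfl
    have h1 : ∀ᶠ t : ℝ in atTop, ∀ p ∈ S, δ ≤ |t - p| := by
      rw [Finset.eventually_all]
      intro p _
      filter_upwards [eventually_ge_atTop (p + δ)] with t ht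
      exact (by linarith : δ ≤ t - p).trans (le_abs_self _)
    filter_upwards [h1] with t ht
    rw [polarPart_eq_zero hδ ht, sub_zero]
  hg_top r := by
    refine (hf.onAxis_decay r).congr' ?_ .rfl
    have h1 : ∀ᶠ t : ℝ in atTop, ∀ p ∈ S, δ ≤ |t⁻¹ - p| := by
      rw [Finset.eventually_all]
      intro p hp
      filter_upwards [tendsto_inv_atTop_zero.eventually_lt_const (sub_pos.2 (hSδ p hp))] with t ht
      rw [abs_sub_comm]
      exact (by linarith : δ ≤ p - t⁻¹).trans (le_abs_self _)
    filter_upwards [h1, eventually_gt_atTop 0] with t ht ht0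
    have : (t : ℂ) ≠ 0 := by exact_mod_cast ht0.ne'
    rw [polarPart_eq_zero hδ ht, sub_zero, hf.onAxis_inv ht0]
    field_simp

/-- The integral over a small semicircle about a simple pole tends to half of the residue
term. -/
theorem tendsto_semicircle {F ψ : ℂ → ℂ} {y : ℝ} (hψ : ∀ᶠ z in 𝓝 (Complex.I * (y : ℂ)),
    ContinuousAt ψ z) (hF : ∀ᶠ z in 𝓝[≠] (Complex.I * (y : ℂ)),
    (z - Complex.I * (y : ℂ)) * F z = ψ z) (σ : ℝ) :
    Tendsto (fun ε : ℝ => ∫ θ in (0 : ℝ)..Real.pi,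
      F (Complex.I * ((y : ℂ) - (ε : ℂ) * Complex.exp ((σ : ℂ) * Complex.I * (θ : ℂ)))) *
        ((ε : ℂ) * (σ : ℂ) * Complex.exp ((σ : ℂ) * Complex.I * (θ : ℂ)))) (𝓝[>] 0)
      (𝓝 (σ * (Complex.I * ψ (Complex.I * (y : ℂ)) * Real.pi))) := by
  set z₀ : ℂ := Complex.I * (y : ℂ) with hz₀
  obtain ⟨r, hr, h1⟩ := Metric.eventually_nhds_iff_ball.1
    ((hψ.and (eventually_nhdsWithin_iff.1 hF)).and
      (hψ.self_of_nhds.norm.eventually (gt_mem_nhds (lt_add_one ‖ψ z₀‖))))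
  set w : ℝ → ℝ → ℂ := fun ε θ =>
    Complex.I * ((y : ℂ) - (ε : ℂ) * Complex.exp ((σ : ℂ) * Complex.I * (θ : ℂ))) with hw
  have hwz (ε θ : ℝ) : w ε θ - z₀ =
      -(Complex.I * ((ε : ℂ) * Complex.exp ((σ : ℂ) * Complex.I * (θ : ℂ)))) := by
    rw [hw, hz₀]; ring
  have hexp (θ : ℝ) : ‖Complex.exp ((σ : ℂ) * Complex.I * (θ : ℂ))‖ = 1 := by
    rw [show (σ : ℂ) * Complex.I * (θ : ℂ) = ((σ * θ : ℝ) : ℂ) * Complex.I by push_cast; ring]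
    exact Complex.norm_exp_ofReal_mul_I _
  have hmem {ε : ℝ} (hε : 0 < ε) (hεr : ε < r) (θ : ℝ) : w ε θ ∈ Metric.ball z₀ r := by
    rw [Metric.mem_ball, dist_eq_norm, hwz]
    simpa [hexp, abs_of_pos hε] using hεr
  -- On the semicircle dz / dθ = i σ (z - z₀), which cancels the pole exactly.
  have hcongr : ∀ᶠ ε in 𝓝[>] (0 : ℝ), ∀ θ : ℝ, F (w ε θ) *
      ((ε : ℂ) * (σ : ℂ) * Complex.exp ((σ : ℂ) * Complex.I * (θ : ℂ))) =
        σ * Complex.I * ψ (w ε θ) := by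
    filter_upwards [self_mem_nhdsWithin, nhdsWithin_le_nhds (gt_mem_nhds hr)] with ε hε hεr θ
    have hε0 : (ε : ℂ) ≠ 0 := by exact_mod_cast (ne_of_gt hε)
    have h2 : w ε θ ≠ z₀ := by
      rw [← sub_ne_zero, hwz]
      simp [hε0]
    rw [← (h1 _ (hmem hε hεr θ)).1.2 h2, hwz]
    linear_combination (F (w ε θ) * ε * σ *
      Complex.exp ((σ : ℂ) * Complex.I * (θ : ℂ))) * Complex.I_sq
  have hlim : Tendsto (fun ε : ℝ => ∫ θ in (0 : ℝ)..Real.pi, σ * Complex.I * ψ (w ε θ)) (𝓝[>] 0)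
      (𝓝 (∫ _ in (0 : ℝ)..Real.pi, σ * Complex.I * ψ z₀)) := by
    refine intervalIntegral.tendsto_integral_filter_of_dominated_convergence
      (fun _ => ‖(σ : ℂ)‖ * (‖ψ z₀‖ + 1)) ?_ ?_ intervalIntegrable_const (.of_forall fun θ _ => ?_)
    · filter_upwards [self_mem_nhdsWithin, nhdsWithin_le_nhds (gt_mem_nhds hr)] with ε hε hεr
      refine Continuous.aestronglyMeasurable (continuous_const.mul ?_)
      refine continuous_iff_continuousAt.2 fun θ => ?_
      exact ContinuousAt.comp (f := w ε) (h1 _ (hmem hε hεr θ)).1.1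
        (Continuous.continuousAt (by rw [hw]; fun_prop))
    · filter_upwards [self_mem_nhdsWithin, nhdsWithin_le_nhds (gt_mem_nhds hr)] with ε hε hεr
      refine .of_forall fun θ _ => ?_
      rw [norm_mul, norm_mul, Complex.norm_I, mul_one]
      gcongr
      exact (h1 _ (hmem hε hεr θ)).2.le
    · refine tendsto_const_nhds.mul (hψ.self_of_nhds.tendsto.comp ?_)
      have : Continuous fun ε : ℝ => w ε θ := by rw [hw]; fun_prop
      have h2 := this.tendsto 0
      rw [show w 0 θ = z₀ by simp [hw, hz₀]] at h2
      exact h2.mono_left nhdsWithin_le_nhds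
  rw [intervalIntegral.integral_const, sub_zero, Complex.real_smul] at hlim
  rw [show (σ : ℂ) * (Complex.I * ψ z₀ * Real.pi) = Real.pi * (σ * Complex.I * ψ z₀) by ring]
  refine hlim.congr' ?_
  filter_upwards [hcongr] with ε hε
  exact intervalIntegral.integral_congr fun θ _ => (hε θ).symm

theorem IsSimpleAxisForm.integrand_eq (hf : IsSimpleAxisForm f c₀) (s : ℂ) {t : ℝ} (ht : 0 < t) :
    integrand f s (Complex.I * (t : ℂ)) * Complex.I = (t : ℂ) ^ (s - 1) * (onAxis f t - c₀) := by
  have h0 : (t : ℂ) ≠ 0 := by exact_mod_cast ht.ne'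
  rw [integrand, hf.valueAtInfty_eq, mul_div_cancel_left₀ _ Complex.I_ne_zero,
    Complex.cpow_sub _ _ h0, Complex.cpow_one, onAxis]
  field_simp

/-- The point is that C does not depend on σ: the limit is odd in σ, so the two sides cancel in the
average. -/
theorem IsSimpleAxisForm.exists_semicircle_limit (hf : IsSimpleAxisForm f c₀) (s : ℂ) {y : ℝ}
    (hy : 0 < y) : ∃ C : ℂ, ∀ σ : ℝ, Tendsto (fun ε : ℝ => ∫ θ in (0 : ℝ)..Real.pi,
      integrand f s (Complex.I * ((y : ℂ) -
        (ε : ℂ) * Complex.exp ((σ : ℂ) * Complex.I * (θ : ℂ)))) *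
        ((ε : ℂ) * (σ : ℂ) * Complex.exp ((σ : ℂ) * Complex.I * (θ : ℂ)))) (𝓝[>] 0)
      (𝓝 (σ * C)) := by
  obtain ⟨r, h, hh, hr⟩ := hf.local_form y hy
  have hy0 : (y : ℂ) ≠ 0 := by exact_mod_cast hy.ne'
  have h1 : ∀ᶠ z in 𝓝 (Complex.I * (y : ℂ)), z ≠ 0 ∧ z / Complex.I ∈ Complex.slitPlane := by
    refine Eventually.and (isOpen_ne.mem_nhds (by simp [hy0])) ?_
    have : Tendsto (fun z : ℂ => z / Complex.I) (𝓝 (Complex.I * (y : ℂ)))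
        (𝓝 (Complex.I * (y : ℂ) / Complex.I)) := tendsto_id.div_const _
    rw [mul_div_cancel_left₀ _ Complex.I_ne_zero] at this
    exact this.eventually (Complex.isOpen_slitPlane.mem_nhds (by simpa using hy))
  refine ⟨_, fun σ => tendsto_semicircle (ψ := fun z => z⁻¹ * (z / Complex.I) ^ s *
    (r + (z - Complex.I * (y : ℂ)) * (h z - c₀))) ?_ ?_ σ⟩
  · filter_upwards [hh.eventually_analyticAt, h1] with z h2 h3
    have h4 := h2.continuousAt
    refine ((continuousAt_inv₀ h3.1).mul ?_).mul (by fun_prop)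
    exact (continuousAt_id.div_const _).cpow continuousAt_const h3.2
  · filter_upwards [hr, self_mem_nhdsWithin] with z h2 h3
    have h3 : z - Complex.I * (y : ℂ) ≠ 0 := sub_ne_zero.2 h3
    rw [integrand, h2, hf.valueAtInfty_eq]
    field_simp
    ring

/-- The imaginary axis without neighbourhoods of radius `ε` of the points of `P`. -/
def puncturedAxis (P : Set ℝ) (ε : ℝ) : Set ℝ := {t | 0 < t ∧ ∀ y ∈ P, ε < |t - y|}

theorem measurableSet_forall_lt_abs_sub {P : Set ℝ} (hP : P.Finite) (ε : ℝ) :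
    MeasurableSet {t : ℝ | ∀ y ∈ P, ε < |t - y|} := by
  have : {t : ℝ | ∀ y ∈ P, ε < |t - y|} = ⋂ y ∈ P, {t | ε < |t - y|} := by
    ext t; simp
  rw [this]
  exact hP.measurableSet_biInter fun y _ => measurableSet_lt (by fun_prop) (by fun_prop)

theorem integrableOn_truncKernel {δ ε : ℝ} (hδ : 0 < δ) (hε : 0 < ε) (p : ℝ) :
    IntegrableOn (fun t : ℝ => (truncKernel δ (t - p) : ℂ)) {t : ℝ | ε < |t - p|} := by
  have hm : MeasurableSet {t : ℝ | ε < |t - p|} := measurableSet_lt (by fun_prop) (by fun_prop)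
  have hmeas : Measurable fun t : ℝ => (truncKernel δ (t - p) : ℂ) :=
    measurable_ofReal.comp ((measurable_truncKernel δ).comp (measurable_id.sub_const p))
  rw [← integrable_indicator_iff hm]
  have h1 : IntegrableOn (Set.indicator {t : ℝ | ε < |t - p|}
      fun t : ℝ => (truncKernel δ (t - p) : ℂ)) (Set.Icc (p - δ) (p + δ)) := by
    refine Measure.integrableOn_of_bounded (M := ε⁻¹) (by simp)
      (hmeas.indicator hm).aestronglyMeasurable (.of_forall fun t => ?_)
    by_cases ht : t ∈ {t : ℝ | ε < |t - p|}
    · rw [Set.indicator_of_mem ht, Complex.norm_real, Real.norm_eq_abs]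
      exact (abs_truncKernel_le _ _).trans (inv_anti₀ hε (le_of_lt ht))
    · rw [Set.indicator_of_notMem ht, norm_zero]
      positivity
  refine (integrableOn_iff_integrable_of_support_subset fun t ht => ?_).1 h1
  have h2 : truncKernel δ (t - p) ≠ 0 := by
    intro h
    simp [h] at ht
  have h3 : |t - p| < δ := by
    by_contra hcon
    exact h2 (truncKernel_eq_zero hδ (not_lt.1 hcon))
  rw [abs_lt] at h3
  constructor <;> linarith

/-- On the support of the kernel at p only the puncture at p matters, and that puncture is symmetric
about p. This is what lets oddness annihilate the integral. -/
theorem puncturedAxis_indicator_truncKernel {P : Set ℝ} {δ ε p : ℝ} (hδ : 0 < δ)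
    (hεδ : ε < δ) (hp : p ∈ P) (hpδ : δ < p) (hsep : ∀ y ∈ P, y ≠ p → 2 * δ < |y - p|) :
    (puncturedAxis P ε).indicator (fun t : ℝ => (truncKernel δ (t - p) : ℂ)) =
      {t : ℝ | ε < |t - p|}.indicator fun t : ℝ => (truncKernel δ (t - p) : ℂ) := by
  ext t
  by_cases h : δ ≤ |t - p|
  · simp [Set.indicator_apply, truncKernel_eq_zero hδ h]
  · rw [not_le] at h
    have h1 : t ∈ puncturedAxis P ε ↔ t ∈ {t : ℝ | ε < |t - p|} := by
      refine ⟨fun ht => ht.2 p hp, fun ht => ⟨by linarith [(abs_lt.1 h).1], fun y hy => ?_⟩⟩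
      by_cases hyp : y = p
      · rw [hyp]; exact ht
      · have h2 := hsep y hy hyp
        have h3 := abs_sub_le y t p
        rw [abs_sub_comm y t] at h3
        linarith
    by_cases ht : t ∈ {t : ℝ | ε < |t - p|}
    · rw [Set.indicator_of_mem ht, Set.indicator_of_mem (h1.2 ht)]
    · rw [Set.indicator_of_notMem ht, Set.indicator_of_notMem (mt h1.1 ht)]

/-- The regularized integral of a form with simple poles is the Mellin transform of its regular
part plus the finite parts of the Mellin transforms of its polar part. -/
theorem IsSimpleAxisForm.hasRegIntegral (hf : IsSimpleAxisForm f c₀) {S : Finset ℝ} {ρ : ℝ → ℂ}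
    {δ : ℝ} (hδ : 0 < δ) (hS : axisPoles f = S) (hSδ : ∀ p ∈ S, δ < p)
    (hsep : ∀ p ∈ S, ∀ y ∈ S, y ≠ p → 2 * δ < |y - p|) {s v : ℂ}
    (hM : HasMellin (fun t => onAxis f t - polarPart S ρ δ t - c₀) s v) :
    HasRegIntegral f s (v + ∑ p ∈ S, ρ p * kernelMellin p δ s) := by
  set K₁ : ℝ → ℂ := fun t => (t : ℂ) ^ (s - 1) • (onAxis f t - polarPart S ρ δ t - c₀) with hK₁
  set K₂ : ℝ → ℝ → ℂ := fun p t => ((t : ℂ) ^ (s - 1) - (p : ℂ) ^ (s - 1)) *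
    (truncKernel δ (t - p) : ℂ) with hK₂
  set K : ℝ → ℂ := fun t => K₁ t + ∑ p ∈ S, ρ p * K₂ p t with hK
  set F : ℝ → ℂ := fun t => (t : ℂ) ^ (s - 1) * (onAxis f t - c₀) with hF
  -- In each polar term t^{s-1} is split as (t^{s-1} - p^{s-1}) + p^{s-1}. The first part goes into
  -- the integrable function K, and the second is a constant multiple of an odd kernel.
  have hFK : F = fun t => K t + ∑ p ∈ S, ρ p * (p : ℂ) ^ (s - 1) *
      (truncKernel δ (t - p) : ℂ) := by
    ext t
    simp only [hF, hK, hK₁, hK₂, polarPart, smul_eq_mul, add_assoc, ← Finset.sum_add_distrib]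
    have : ∀ p ∈ S, ρ p * (((t : ℂ) ^ (s - 1) - (p : ℂ) ^ (s - 1)) *
        (truncKernel δ (t - p) : ℂ)) + ρ p * (p : ℂ) ^ (s - 1) * (truncKernel δ (t - p) : ℂ) =
        (t : ℂ) ^ (s - 1) * (ρ p * (truncKernel δ (t - p) : ℂ)) := fun p _ => by ring
    rw [Finset.sum_congr rfl this, ← Finset.mul_sum]
    ring
  have hP : (axisPoles f).Finite := by rw [hS]; exact S.finite_toSet
  have hsupp (p : ℝ) (t : ℝ) (ht : t ∉ Set.Icc (p - δ) (p + δ)) : K₂ p t = 0 := by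
    have : δ ≤ |t - p| := by
      by_contra hcon
      rw [not_le, abs_lt] at hcon
      exact ht ⟨by linarith, by linarith⟩
    simp [hK₂, truncKernel_eq_zero hδ this]
  have hK₂int (p : ℝ) (hp : p ∈ S) : IntegrableOn (K₂ p) (Set.Ioi 0) := by
    refine Integrable.integrableOn ?_
    refine (integrableOn_iff_integrable_of_support_subset fun t ht => ?_).1
      (integrableOn_kernel hδ (hSδ p hp) s)
    by_contra hcon
    exact ht (hsupp p t hcon)
  have hKint : IntegrableOn K (Set.Ioi 0) :=
    Integrable.add hM.1 (integrable_finsetSum _ fun p hp => (hK₂int p hp).const_mul _)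
  have hKval : ∫ t in Set.Ioi (0 : ℝ), K t = v + ∑ p ∈ S, ρ p * kernelMellin p δ s := by
    have h1 : ∫ t in Set.Ioi (0 : ℝ), K₁ t = v := hM.2
    rw [hK, integral_add hM.1 (integrable_finsetSum _ fun p hp => (hK₂int p hp).const_mul _),
      h1, integral_finsetSum _ fun p hp => (hK₂int p hp).const_mul _]
    congr 1
    refine Finset.sum_congr rfl fun p hp => ?_
    rw [integral_const_mul, kernelMellin]
    congr 1
    refine setIntegral_eq_of_subset_of_forall_sdiff_eq_zero measurableSet_Ioi (fun t ht => ?_)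
      fun t ht => hsupp p t ht.2
    have := hSδ p hp
    exact lt_of_lt_of_le (by linarith) ht.1
  have hEm (ε : ℝ) : MeasurableSet (puncturedAxis (axisPoles f) ε) :=
    measurableSet_Ioi.inter (measurableSet_forall_lt_abs_sub hP ε)
  have hEsub (ε : ℝ) : puncturedAxis (axisPoles f) ε ⊆ Set.Ioi 0 := fun t ht => ht.1
  have htk (ε : ℝ) (hε : 0 < ε) (p : ℝ) (hp : p ∈ S) :
      IntegrableOn (fun t : ℝ => (truncKernel δ (t - p) : ℂ)) (puncturedAxis (axisPoles f) ε) := by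
    refine (integrableOn_truncKernel hδ hε p).mono_set fun t ht => ht.2 p ?_
    rw [hS]; exact hp
  have hsumint (ε : ℝ) (hε : 0 < ε) : IntegrableOn (fun t : ℝ => ∑ p ∈ S,
      ρ p * (p : ℂ) ^ (s - 1) * (truncKernel δ (t - p) : ℂ)) (puncturedAxis (axisPoles f) ε) :=
    integrable_finsetSum _ fun p hp => (htk ε hε p hp).const_mul _
  have hFint (ε : ℝ) (hε : 0 < ε) : IntegrableOn F (puncturedAxis (axisPoles f) ε) := by
    rw [hFK]
    exact (hKint.mono_set (hEsub ε)).add (hsumint ε hε)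
  -- The odd kernels integrate to zero over the symmetrically punctured axis, so the divergent part
  -- disappears before ε → 0.
  have hFval (ε : ℝ) (hε : 0 < ε) (hεδ : ε < δ) :
      ∫ t in puncturedAxis (axisPoles f) ε, F t = ∫ t in puncturedAxis (axisPoles f) ε, K t := by
    rw [hFK, integral_add (hKint.mono_set (hEsub ε)) (hsumint ε hε),
      integral_finsetSum _ fun p hp => (htk ε hε p hp).const_mul _]
    rw [Finset.sum_eq_zero, add_zero]
    intro p hp
    have hpS : p ∈ axisPoles f := by rw [hS]; exact hp
    rw [integral_const_mul, ← integral_indicator (hEm ε),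
      puncturedAxis_indicator_truncKernel hδ hεδ hpS (hSδ p hp)
        (fun y hy => hsep p hp y (by rw [hS] at hy; exact hy)),
      integral_indicator (measurableSet_lt (by fun_prop) (by fun_prop)),
      setIntegral_truncKernel_eq_zero, mul_zero]
  set semi : ℝ → ℝ → ℝ → ℂ := fun σ ε y => ∫ θ in (0 : ℝ)..Real.pi,
      integrand f s (Complex.I * ((y : ℂ) -
        (ε : ℂ) * Complex.exp ((σ : ℂ) * Complex.I * (θ : ℂ)))) *
        ((ε : ℂ) * (σ : ℂ) * Complex.exp ((σ : ℂ) * Complex.I * (θ : ℂ))) with hsemi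
  -- Once (1 / Λ, Λ) contains all poles, the semicircular terms no longer depend on Λ.
  have hcontour (ε σ : ℝ) : ∀ᶠ Λ : ℝ in atTop, contourIntegral f s Λ ε σ =
      (∫ t in puncturedAxis (axisPoles f) ε ∩ Set.Icc Λ⁻¹ Λ, F t) + ∑ y ∈ S, semi σ ε y := by
    have h1 : ∀ᶠ Λ : ℝ in atTop, ∀ y ∈ S, y ∈ Set.Ioo Λ⁻¹ Λ := by
      rw [Finset.eventually_all]
      intro y hy
      have hy0 : 0 < y := hδ.trans (hSδ y hy)
      filter_upwards [eventually_gt_atTop y, tendsto_inv_atTop_zero.eventually_lt_const hy0]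
        with Λ h2 h3 using ⟨h3, h2⟩
    filter_upwards [h1, eventually_gt_atTop 0] with Λ h2 h3
    rw [contourIntegral]
    congr 1
    · have h4 : {t : ℝ | t ∈ Set.Icc Λ⁻¹ Λ ∧ ∀ y ∈ axisPoles f, ε < |t - y|} =
          puncturedAxis (axisPoles f) ε ∩ Set.Icc Λ⁻¹ Λ := by
        ext t
        constructor
        · exact fun ht => ⟨⟨(inv_pos.2 h3).trans_le ht.1.1, ht.2⟩, ht.1⟩
        · exact fun ht => ⟨ht.2, ht.1.2⟩
      rw [h4]
      refine setIntegral_congr_fun ((hEm ε).inter measurableSet_Icc) fun t ht => ?_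
      exact hf.integrand_eq s ht.1.1
    · have h4 : axisPoles f ∩ Set.Ioo Λ⁻¹ Λ = S := by
        rw [hS]
        exact Set.inter_eq_left.2 h2
      rw [h4]
      exact finsum_mem_coe_finset _ _
  refine ⟨hP, fun ε => (∫ t in puncturedAxis (axisPoles f) ε, F t) +
    (∑ y ∈ S, semi 1 ε y + ∑ y ∈ S, semi (-1) ε y) / 2, ?_, ?_⟩
  · filter_upwards [self_mem_nhdsWithin] with ε hε
    have h1 : Tendsto (fun Λ : ℝ => ∫ t in puncturedAxis (axisPoles f) ε ∩ Set.Icc Λ⁻¹ Λ, F t) atTop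
        (𝓝 (∫ t in puncturedAxis (axisPoles f) ε, F t)) := by
      refine tendsto_setIntegral_inter (hFint ε hε) (fun Λ => measurableSet_Icc) ?_
      filter_upwards [ae_restrict_mem (hEm ε)] with t ht
      filter_upwards [eventually_ge_atTop t, tendsto_inv_atTop_zero.eventually_le_const ht.1]
        with Λ h2 h3 using ⟨h3, h2⟩
    refine (h1.add_const _).congr' ?_
    filter_upwards [hcontour ε 1, hcontour ε (-1)] with Λ h2 h3
    rw [h2, h3]
    ring
  · have h1 : Tendsto (fun ε : ℝ => ∫ t in puncturedAxis (axisPoles f) ε, F t) (𝓝[>] 0)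
        (𝓝 (∫ t in Set.Ioi (0 : ℝ), K t)) := by
      have h2 : Tendsto (fun ε : ℝ => ∫ t in Set.Ioi 0 ∩ {t : ℝ | ∀ y ∈ axisPoles f, ε < |t - y|},
          K t) (𝓝[>] 0) (𝓝 (∫ t in Set.Ioi (0 : ℝ), K t)) := by
        refine tendsto_setIntegral_inter hKint (measurableSet_forall_lt_abs_sub hP) ?_
        have h3 : ∀ᵐ t : ℝ, t ∉ axisPoles f := by
          rw [ae_iff]
          simpa using hP.measure_zero volume
        filter_upwards [ae_restrict_of_ae h3] with t ht
        refine (hP.eventually_all).2 fun y hy => nhdsWithin_le_nhds (gt_mem_nhds ?_)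
        exact abs_pos.2 (sub_ne_zero.2 fun h => ht (h ▸ hy))
      refine h2.congr' ?_
      filter_upwards [self_mem_nhdsWithin, nhdsWithin_le_nhds (gt_mem_nhds hδ)] with ε hε hεδ
      rw [hFval ε hε hεδ]
      rfl
    have h2 : Tendsto (fun ε : ℝ => ∑ y ∈ S, semi 1 ε y + ∑ y ∈ S, semi (-1) ε y) (𝓝[>] 0)
        (𝓝 0) := by
      simp only [← Finset.sum_add_distrib]
      have h3 : (∑ _y ∈ S, (0 : ℂ)) = 0 := Finset.sum_const_zero
      rw [← h3]
      refine tendsto_finsetSum S fun y hy => ?_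
      obtain ⟨C, hC⟩ := hf.exists_semicircle_limit s (hδ.trans (hSδ y hy))
      have h3 : Tendsto (fun ε : ℝ => semi 1 ε y + semi (-1) ε y) (𝓝[>] 0)
          (𝓝 (((1 : ℝ) : ℂ) * C + ((-1 : ℝ) : ℂ) * C)) := Tendsto.add (hC 1) (hC (-1))
      rwa [← add_mul, ← Complex.ofReal_add, add_neg_cancel, Complex.ofReal_zero, zero_mul] at h3
    have := h1.add (h2.div_const 2)
    rwa [zero_div, add_zero, hKval] at this

/-! ### The regularized L-function -/

/-- The completed regularized L-function is entire up to the poles prescribed by the functional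
equation. -/
theorem IsSimpleAxisForm.exists_completed (hf : IsSimpleAxisForm f c₀) :
    ∃ A : ℂ → ℂ, Differentiable ℂ A ∧ ∀ s : ℂ, 2 < s.re →
      HasRegIntegral f s (A s - c₀ / s + c₀ / (2 - s)) := by
  have hP := hf.finite_axisPoles
  obtain ⟨δ, hδ, h1, h2⟩ := exists_separation hP fun p hp => hp.1
  obtain ⟨ρ, h3, h4⟩ := hf.exists_residue
  set S := hP.toFinset with hS
  have hPS : axisPoles f = S := by simp [hS]
  have hSδ : ∀ p ∈ S, δ < p := fun p hp => h1 p (by simpa [hS] using hp)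
  have hreg (t : ℝ) (ht : 0 < t) : IsRegularAt (fun s => onAxis f s - polarPart S ρ δ s) t :=
    isRegularAt_sub_polarPart hδ (h3 t ht) fun htS => h4 t ht (by simpa [hS] using htS)
  set W := hf.fePair S ρ δ hδ hSδ hreg with hW
  refine ⟨fun s => W.Λ₀ s + ∑ p ∈ S, ρ p * kernelMellin p δ s, ?_, fun s hs => ?_⟩
  · refine W.differentiable_Λ₀.add (Differentiable.fun_sum fun p hp => ?_)
    exact (differentiable_kernelMellin hδ (hSδ p hp)).const_mul _
  · have hM : HasMellin (fun t => onAxis f t - polarPart S ρ δ t - c₀) s (W.Λ s) :=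
      W.hasMellin (s := s) hs
    have := hf.hasRegIntegral hδ hPS hSδ
      (fun p hp y hy => h2 p (by simpa [hS] using hp) y (by simpa [hS] using hy)) hM
    convert this using 1
    have h5 : W.Λ s = W.Λ₀ s - (1 / s) • c₀ - ((-1 : ℂ) / (((2 : ℝ) : ℂ) - s)) • c₀ := rfl
    rw [h5]
    simp only [smul_eq_mul, Complex.ofReal_ofNat]
    ring

theorem HasRegIntegral.unique {s v w : ℂ} (hv : HasRegIntegral f s v) (hw : HasRegIntegral f s w) :
    v = w := by
  obtain ⟨-, G, h1, h2⟩ := hv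
  obtain ⟨-, G', h3, h4⟩ := hw
  refine tendsto_nhds_unique h2 (h4.congr' ?_)
  filter_upwards [h1, h3] with ε h5 h6 using tendsto_nhds_unique h6 h5

/-- Both functions are determined on Re s > 2 by uniqueness of limits. The identity theorem for
meromorphic functions then propagates the equality from the point 3 to all of ℂ, up to isolated
points. -/
theorem IsRegLFunction.eventuallyEq {L L' : ℂ → ℂ} (hL : IsRegLFunction 2 f L)
    (hL' : IsRegLFunction 2 f L') (s : ℂ) : L =ᶠ[𝓝[≠] s] L' := by
  have hm : Meromorphic (L - L') := hL.1.sub hL'.1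
  have h3 : meromorphicOrderAt (L - L') 3 = ⊤ := by
    rw [meromorphicOrderAt_eq_top_iff]
    have : ∀ᶠ z : ℂ in 𝓝 3, 2 < z.re :=
      Complex.continuous_re.continuousAt.eventually (lt_mem_nhds (by norm_num))
    filter_upwards [nhdsWithin_le_nhds this] with z hz
    obtain ⟨v, hv, h1⟩ := hL.2 z (by linarith) (by exact_mod_cast hz)
    obtain ⟨w, hw, h2⟩ := hL'.2 z (by linarith) (by exact_mod_cast hz)
    rw [Pi.sub_apply, h1, h2, hv.unique hw, sub_self]
  have hs : meromorphicOrderAt (L - L') s = ⊤ := by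
    by_contra hcon
    exact MeromorphicOn.meromorphicOrderAt_ne_top_of_isPreconnected (x := s)
      (fun z _ => hm z) isPreconnected_univ (Set.mem_univ _) (Set.mem_univ (3 : ℂ)) hcon h3
  filter_upwards [meromorphicOrderAt_eq_top_iff.1 hs] with z hz
  exact sub_eq_zero.1 hz

theorem IsSimpleAxisForm.exists_regLFunction (hf : IsSimpleAxisForm f c₀) :
    ∃ L : ℂ → ℂ, IsRegLFunction 2 f L ∧ Tendsto L (𝓝[≠] 0) (𝓝 (-c₀)) ∧
      ∃ v : ℂ, Tendsto L (𝓝[≠] 1) (𝓝 v) := by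
  obtain ⟨A, hA, hreg⟩ := hf.exists_completed
  have hpi : ((2 * Real.pi : ℝ) : ℂ) ≠ 0 := by
    exact_mod_cast Real.two_pi_pos.ne'
  have hpow : Differentiable ℂ fun s : ℂ => ((2 * Real.pi : ℝ) : ℂ) ^ s :=
    fun s => differentiableAt_id.const_cpow (Or.inl hpi)
  have hΓ : Differentiable ℂ fun s : ℂ => (Complex.Gamma s)⁻¹ :=
    Complex.differentiable_one_div_Gamma
  set L : ℂ → ℂ := fun s => ((2 * Real.pi : ℝ) : ℂ) ^ s / Complex.Gamma s *
    (A s - c₀ / s + c₀ / (2 - s)) with hL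
  refine ⟨L, ⟨fun s => ?_, fun s _ hs => ⟨_, hreg s (by exact_mod_cast hs), rfl⟩⟩, ?_, ?_⟩
  · have h1 := (hpow.analyticAt s).meromorphicAt
    have h2 := (hΓ.analyticAt s).meromorphicAt
    have h3 := (hA.analyticAt s).meromorphicAt
    have h4 : MeromorphicAt (fun s : ℂ => A s - c₀ / s + c₀ / (2 - s)) s := by fun_prop
    exact (h1.mul h2).mul h4
  -- The term c₀ / (s Γ(s)) is rewritten as c₀ / Γ(s + 1), which is regular at 0. All other terms
  -- are killed by the zero of 1 / Γ at 0, here `Complex.Gamma_zero` together with the convention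
  -- 0⁻¹ = 0.
  · have h1 : Tendsto (fun s : ℂ => ((2 * Real.pi : ℝ) : ℂ) ^ s * (Complex.Gamma s)⁻¹ *
        (A s + c₀ / (2 - s)) - ((2 * Real.pi : ℝ) : ℂ) ^ s * c₀ * (Complex.Gamma (s + 1))⁻¹) (𝓝 0)
        (𝓝 (((2 * Real.pi : ℝ) : ℂ) ^ (0 : ℂ) * (Complex.Gamma 0)⁻¹ *
        (A 0 + c₀ / (2 - 0)) - ((2 * Real.pi : ℝ) : ℂ) ^ (0 : ℂ) * c₀ *
          (Complex.Gamma (0 + 1))⁻¹)) := by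
      have h2 : ContinuousAt (fun s : ℂ => c₀ / (2 - s)) 0 :=
        continuousAt_const.div (by fun_prop) (by norm_num)
      have h3 : Continuous fun s : ℂ => (Complex.Gamma (s + 1))⁻¹ :=
        hΓ.continuous.comp (continuous_add_const 1)
      exact ((hpow.continuous.mul hΓ.continuous).continuousAt.mul
        (hA.continuous.continuousAt.add h2)).sub
        ((hpow.continuous.mul continuous_const).mul h3).continuousAt
    rw [Complex.Gamma_zero, inv_zero, mul_zero, zero_mul, Complex.cpow_zero, zero_add,
      Complex.Gamma_one, inv_one, one_mul, mul_one, zero_sub] at h1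
    refine (h1.mono_left nhdsWithin_le_nhds).congr' ?_
    filter_upwards [self_mem_nhdsWithin] with s hs
    have hs : s ≠ 0 := hs
    rw [Complex.Gamma_add_one s hs, mul_inv]
    simp only [hL]
    ring
  · refine ⟨L 1, ContinuousAt.tendsto ?_ |>.mono_left nhdsWithin_le_nhds⟩
    have h2 : ContinuousAt (fun s : ℂ => c₀ / (2 - s)) 1 :=
      continuousAt_const.div (by fun_prop) (by norm_num)
    have h3 : ContinuousAt (fun s : ℂ => c₀ / s) 1 :=
      continuousAt_const.div continuousAt_id one_ne_zero
    exact (hpow.continuous.mul hΓ.continuous).continuousAt.mul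
      ((hA.continuous.continuousAt.sub h3).add h2)

/-! ### The form `Λ_d` -/

theorem isSimpleAxisForm_sum_lamTerm {ι : Type*} (s : Finset ι) (c x : ι → ℂ) :
    IsSimpleAxisForm (fun τ => ∑ i ∈ s, c i * lamTerm (x i) τ) (∑ i ∈ s, c i) where
  local_form t ht := by
    have him : 0 < (Complex.I * (t : ℂ)).im := by simpa using ht
    choose r h hh hr using fun i => lamTerm_local (x i) him
    refine ⟨∑ i ∈ s, c i * r i, fun z => ∑ i ∈ s, c i * h i z, ?_, ?_⟩
    · exact Finset.analyticAt_fun_sum _ fun i _ => analyticAt_const.mul (hh i)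
    · have h1 := (Finset.eventually_all s).2 fun i _ => hr i
      filter_upwards [h1] with z hz
      rw [Finset.sum_div, ← Finset.sum_add_distrib]
      refine Finset.sum_congr rfl fun i hi => ?_
      rw [hz i hi]
      ring
  S_smul τ := by
    simp only [lamTerm_S_smul, Finset.mul_sum]
    exact Finset.sum_congr rfl fun i _ => by ring
  decay := by
    obtain ⟨u, hu⟩ := exists_hasCuspForm_jInv
    have h1 (i : ι) : (fun τ => lamTerm (x i) τ - 1) =O[atImInfty]
        fun τ : ℍ => Function.Periodic.qParam 1 (τ : ℂ) := by
      have ha := analyticAt_cuspLogDeriv hu.1 hu.2.1 (x i)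
      have h2 := ha.differentiableAt.isBigO_sub.comp_tendsto (qParam_tendsto_atImInfty one_pos)
      refine h2.congr' ?_ ?_
      · filter_upwards [eventually_lamTerm hu (x i)] with τ hτ
        simp [hτ, hu.2.1]
      · exact .of_forall fun τ => by simp
    have h2 : (fun τ => ∑ i ∈ s, c i * lamTerm (x i) τ - ∑ i ∈ s, c i) =
        fun τ => ∑ i ∈ s, c i * (lamTerm (x i) τ - 1) := by
      ext τ
      rw [← Finset.sum_sub_distrib]
      exact Finset.sum_congr rfl fun i _ => by ring
    rw [h2]
    exact Asymptotics.IsBigO.fun_sum fun i _ => (h1 i).const_mul_left _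

/-- Termwise, the coefficients are values of the J_n by `taylorCoeff_eq_modJ`. The index 0 is
separate because the constant coefficient of each term is 1. -/
theorem hasQExpansion_sum_lamTerm {ι : Type*} (s : Finset ι) (c : ι → ℂ) (α : ι → ℍ) :
    HasQExpansion (fun τ => ∑ i ∈ s, c i * lamTerm (jInv (α i)) τ)
      fun n => if n = 0 then ∑ i ∈ s, c i else ∑ i ∈ s, c i * modJ n (α i) := by
  obtain ⟨u, hu⟩ := exists_hasCuspForm_jInv
  have ha (i : ι) := analyticAt_cuspLogDeriv hu.1 hu.2.1 (jInv (α i))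
  have h1 : ∀ᶠ τ : ℍ in atImInfty, ∀ i ∈ s,
      lamTerm (jInv (α i)) τ = (fun q => (u q - q * deriv u q) / (u q - jInv (α i) * q))
        (Function.Periodic.qParam 1 τ) :=
    (Finset.eventually_all s).2 fun i _ => eventually_lamTerm hu _
  have h2 : ∀ᶠ τ : ℍ in atImInfty, ∀ i ∈ s, HasSum (fun n : ℕ => taylorCoeff n
      (fun q => (u q - q * deriv u q) / (u q - jInv (α i) * q)) *
      Function.Periodic.qParam 1 τ ^ n)
      ((fun q => (u q - q * deriv u q) / (u q - jInv (α i) * q))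
        (Function.Periodic.qParam 1 τ)) :=
    (Finset.eventually_all s).2 fun i _ =>
      (qParam_tendsto_atImInfty one_pos).eventually (hasSum_taylorCoeff (ha i))
  filter_upwards [h1, h2] with τ h3 h4
  have h5 := hasSum_sum (s := s) fun i hi => ((h4 i hi).mul_left (c i))
  rw [Finset.sum_congr rfl fun i hi => by rw [← h3 i hi]] at h5
  have h6 (n : ℕ) : (if n = 0 then ∑ i ∈ s, c i else ∑ i ∈ s, c i * modJ n (α i)) * qPow n τ =
      ∑ i ∈ s, c i * (taylorCoeff n
        (fun q => (u q - q * deriv u q) / (u q - jInv (α i) * q)) *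
        Function.Periodic.qParam 1 τ ^ n) := by
    rw [qPow_eq_zpow, zpow_natCast]
    split_ifs with hn
    · simp [hn, taylorCoeff_zero, hu.2.1]
    · rw [Finset.sum_mul]
      exact Finset.sum_congr rfl fun i _ => by rw [taylorCoeff_eq_modJ hu]; ring
  simpa only [h6] using h5

theorem exists_lam_eq_sum {d : ℕ} (hd : 0 < d) : ∃ (ι : Type) (s : Finset ι) (c : ι → ℂ)
    (α : ι → ℍ), Lam d = (fun τ => ∑ i ∈ s, c i * lamTerm (jInv (α i)) τ) ∧
      (hurwitz d : ℂ) = ∑ i ∈ s, c i ∧ ∀ n, trace n d = ∑ i ∈ s, c i * modJ n (α i) := by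
  have := finite_formClass hd
  have := Fintype.ofFinite (FormClass d)
  refine ⟨FormClass d, Finset.univ, fun C => 1 / (C.w : ℂ), fun C => C.alpha, ?_, ?_, fun n => ?_⟩
  · ext τ
    rw [Lam, finsum_eq_sum_of_fintype, Finset.mul_sum]
    refine Finset.sum_congr rfl fun C _ => ?_
    rw [lamTerm]
    ring
  · rw [hurwitz, finsum_eq_sum_of_fintype]
    push_cast
    rfl
  · rw [trace, finsum_eq_sum_of_fintype]

end SingularModuli
end

theorem mainTheorem5 (d : ℕ) (hd : 0 < d) (hd4 : d % 4 = 0 ∨ d % 4 = 3) :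
    (∀ n : ℕ, 1 ≤ n → ∃! f : ℍ → ℂ, SingularModuli.IsModularFunctionJ n f) ∧
    SingularModuli.IsMeromorphicModularForm 2 (SingularModuli.Lam d) ∧
    SingularModuli.HasQExpansion (SingularModuli.Lam d)
      (fun n => if n = 0 then (SingularModuli.hurwitz d : ℂ) else SingularModuli.trace n d) ∧
    (∃ L : ℂ → ℂ, SingularModuli.IsRegLFunction 2 (SingularModuli.Lam d) L) ∧
    (∀ L : ℂ → ℂ, SingularModuli.IsRegLFunction 2 (SingularModuli.Lam d) L →
      Tendsto L (𝓝[≠] 0) (𝓝 (-(SingularModuli.hurwitz d : ℂ))) ∧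
      ∃ v : ℂ, Tendsto L (𝓝[≠] 1) (𝓝 v)) ∧
    SingularModuli.HasRegSum (fun n => SingularModuli.trace n d)
      (-(SingularModuli.hurwitz d : ℂ)) := by
  obtain ⟨ι, s, c, α, hLam, hH, ht⟩ := SingularModuli.exists_lam_eq_sum hd
  have hmod := SingularModuli.isMeromorphicModularForm_sum_lamTerm s c fun i =>
    SingularModuli.jInv (α i)
  have hq := SingularModuli.hasQExpansion_sum_lamTerm s c α
  have hax := SingularModuli.isSimpleAxisForm_sum_lamTerm s c fun i => SingularModuli.jInv (α i)
  simp only [← hLam, ← hH, ← ht] at hmod hq hax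
  obtain ⟨L, hL, h0, v, h1⟩ := hax.exists_regLFunction
  refine ⟨fun n _ => ?_, hmod, hq, ⟨L, hL⟩, fun L' hL' => ⟨?_, v, ?_⟩, 2, _, _, L, hmod, hq, hL, h0⟩
  · obtain ⟨f, hf⟩ := SingularModuli.exists_isModularFunctionJ n
    exact ⟨f, hf, fun g hg => hg.unique hf⟩
  -- The limits were computed for one explicit continuation; any other agrees with it on a punctured
  -- neighbourhood.
  · exact h0.congr' (hL.eventuallyEq hL' 0)
  · exact h1.congr' (hL.eventuallyEq hL' 1)
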